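/- Let $F$ be a field of characteristic $2$ and let $F_s$ be a separable closure of $F$; all extensions of $F$ are taken inside $F_s$. For a field $K$ of characteristic $2$ write $\wp(x)=x^2-x$, let $[x]_K$ denote the class of $x\in K$ in the $\mathbb F_2$-vector space $K/\wp(K)$, and for a set $S\subseteq K/\wp(K)$ let $K(\wp^{-1}S)$ be the field generated over $K$ by all $\theta\in F_s$ with $\wp(\theta)=a$ for some $a\in K$ with $[a]_K\in S$. Let $U_4(\mathbb F_2)$ be the group of upper triangular $4\times4$ matrices over $\mathbb F_2$ with all diagonal entries equal to $1$, and put $E_{ij}=1+e_{ij}$, where $e_{ij}$ is the matrix with entry $1$ in position $(i,j)$ and $0$ elsewhere. A Galois $U_4(\mathbb F_2)$-extension of $F$ is a finite Galois extension $L/F$ with $\mathrm{Gal}(L/F)\simeq U_4(\mathbb F_2)$. A triple $([b]_F,V,W)$, where $b\in F$, $V$ is an $\mathbb F_2$-subspace of $F/\wp(F)$ and $W$ is an $\mathbb F_2[\mathrm{Gal}(E/F)]$-submodule of $E/\wp(E)$ for $E=F(\wp^{-1}V)$, is called admissible if $\dim_{\mathbb F_2}V=2$, $\dim_{\mathbb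 F_2}\langle V,[b]_F\rangle=3$, and $W$ is a free $\mathbb F_2[\mathrm{Gal}(E/F)]$-module generated by an element $[\delta]_E$ with $[\mathrm{Tr}_{E/F}(\delta)]_F=[b]_F$. Theorem. The rule $([b]_F,V,W)\mapsto L=E(\wp^{-1}W)$, where $E=F(\wp^{-1}V)$, defines a bijection from the set of admissible triples onto the set of Galois $U_4(\mathbb F_2)$-extensions $L/F$. Its inverse is described as follows. Let $L/F$ be a Galois $U_4(\mathbb F_2)$-extension, let $\rho\colon\mathrm{Gal}(L/F)\to U_4(\mathbb F_2)$ be any isomorphism, and put $\sigma_1=\rho^{-1}(E_{12})$, $\sigma_2=\rho^{-1}(E_{23})$, $\sigma_3=\rho^{-1}(E_{34})$. Then there are $a,b,c\in F$ and $\theta_a,\theta_b,\theta_c\in L$ with $\wp(\theta_a)=a$, $\wp(\theta_b)=b$, $\wp(\theta_c)=c$ such that $\sigma_1$ sends $\theta_a$ to $\theta_a+1$ and fixes $\theta_b,\theta_c$; $\sigma_2$ sends $\theta_b$ to $\theta_b+1$ and fixes $\theta_a,\theta_c$; and $\sigma_3$ sends $\theta_c$ to $\theta_c+1$ and fixes $\theta_a,\theta_b$.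 For every such choice of $\rho,a,b,c$, the triple corresponding to $L$ is $([b]_F,V,W)$ with $V=\langle[a]_F,[c]_F\rangle$ and $W=(E\cap\wp(L))/\wp(E)$, where $E=F(\wp^{-1}V)$; in particular this triple does not depend on $\rho$. -/

import Mathlib

noncomputable section

namespace ArtinSchreier

section Quotient

variable (K : Type*) [Field K] [CharP K 2]

/-- The Artin-Schreier map `x ↦ x ^ 2 - x` of a field of characteristic `2`, as an additive map. -/
def wp : K →+ K where
  toFun x := x ^ 2 - x
  map_zero' := by simp
  map_add' x y := by rw [CharTwo.add_sq]; ring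

/-- The quotient group `K / ℘(K)`. -/
def ASQuot : Type _ := K ⧸ (wp K).range

instance : AddCommGroup (ASQuot K) := inferInstanceAs (AddCommGroup (K ⧸ (wp K).range))

variable {K}

/-- The class `[x]_K` of `x` in `K / ℘(K)`. -/
def cls : K →+ ASQuot K := QuotientAddGroup.mk' (wp K).range

theorem cls_surjective : Function.Surjective (cls (K := K)) :=
  QuotientAddGroup.mk'_surjective _

theorem cls_eq_zero_iff (x : K) : cls x = 0 ↔ ∃ y : K, y ^ 2 - y = x :=
  QuotientAddGroup.eq_zero_iff x

variable (K)

/-- `K / ℘(K)` as a vector space over `𝔽₂`. -/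
instance : Module (ZMod 2) (ASQuot K) :=
  AddCommGroup.zmodModule (n := 2) fun x => by
    obtain ⟨y, rfl⟩ := cls_surjective x
    rw [← map_nsmul, two_nsmul, CharTwo.add_self_eq_zero, map_zero]

end Quotient

section Galois

variable {K E : Type*} [Field K] [Field E] [CharP E 2] [Algebra K E]

/-- The additive endomorphism of `E / ℘(E)` induced by an automorphism of `E` over `K`. -/
def galMap (σ : Gal(E/K)) : ASQuot E →+ ASQuot E :=
  QuotientAddGroup.map (wp E).range (wp E).range (σ : E →+ E) (by
    rintro _ ⟨y, rfl⟩
    exact ⟨σ y, by simp [wp]⟩)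

@[simp]
theorem galMap_cls (σ : Gal(E/K)) (x : E) : galMap σ (cls x) = cls (σ x) := rfl

variable (K E)

/-- The action of `Gal(E/K)` on `E / ℘(E)`, given by `σ [x]_E = [σ x]_E`,
as a representation over `𝔽₂`. -/
def galRep : Representation (ZMod 2) Gal(E/K) (ASQuot E) where
  toFun σ := (galMap σ).toZModLinearMap 2
  map_one' := by
    ext x
    obtain ⟨y, rfl⟩ := cls_surjective x
    rfl
  map_mul' σ τ := by
    ext x
    obtain ⟨y, rfl⟩ := cls_surjective x
    rfl

/-- `E / ℘(E)` as a module over the group ring `𝔽₂[Gal(E/K)]`. -/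
instance : Module (MonoidAlgebra (ZMod 2) Gal(E/K)) (ASQuot E) :=
  Module.compHom (ASQuot E) (galRep K E).asAlgebraHom.toRingHom

theorem single_one_smul_cls (σ : Gal(E/K)) (x : E) :
    (MonoidAlgebra.single σ (1 : ZMod 2)) • (cls x : ASQuot E) = cls (σ x) := by
  change (galRep K E).asAlgebraHom (MonoidAlgebra.single σ (1 : ZMod 2)) (cls x) = _
  rw [Representation.asAlgebraHom_single_one]
  rfl

end Galois

/-- For a set `S` of classes in `K / ℘(K)`, the extension `K(℘⁻¹(S))` of `K` inside `Ω`, generated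
by all the roots `θ` of the polynomials `X ^ 2 - X - a` with `[a]_K ∈ S`. -/
def rootField {K : Type*} (Ω : Type*) [Field K] [CharP K 2] [Field Ω] [Algebra K Ω]
    (S : Set (ASQuot K)) : IntermediateField K Ω :=
  IntermediateField.adjoin K {θ : Ω | ∃ a : K, cls a ∈ S ∧ θ ^ 2 - θ = algebraMap K Ω a}

end ArtinSchreier

/-- The group `U_n(R)` of upper triangular matrices with all diagonal entries equal to `1`. -/
def unipotentGroup (n : ℕ) (R : Type*) [CommRing R] : Subgroup (GL (Fin n) R) where
  carrier := {M | (∀ i j, j < i → (M : Matrix (Fin n) (Fin n) R) i j = 0) ∧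
    ∀ i, (M : Matrix (Fin n) (Fin n) R) i i = 1}
  one_mem' := ⟨fun i j h => by simp [h.ne'], fun i => by simp⟩
  mul_mem' {M N} hM hN := by
    refine ⟨fun i j h => ?_, fun i => ?_⟩
    · rw [Units.val_mul, Matrix.mul_apply]
      refine Finset.sum_eq_zero fun k _ => ?_
      rcases lt_or_ge k i with hk | hk
      · rw [hM.1 i k hk, zero_mul]
      · rw [hN.1 k j (h.trans_le hk), mul_zero]
    · rw [Units.val_mul, Matrix.mul_apply, Finset.sum_eq_single i, hM.2, hN.2, one_mul]
      · intro k _ hk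
        rcases lt_or_gt_of_ne hk with hk | hk
        · rw [hM.1 i k hk, zero_mul]
        · rw [hN.1 k i hk, mul_zero]
      · simp
  inv_mem' {M} hM := by
    have hT : ∀ i j, j < i → ((M⁻¹ : GL (Fin n) R) : Matrix (Fin n) (Fin n) R) i j = 0 := by
      have : Invertible (M : Matrix (Fin n) (Fin n) R) := M.invertible
      have h := Matrix.blockTriangular_inv_of_blockTriangular
        (M := (M : Matrix (Fin n) (Fin n) R)) (b := id) (fun i j h => hM.1 i j h)
      intro i j hij
      rw [Matrix.coe_units_inv]
      exact h hij
    refine ⟨hT, fun i => ?_⟩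
    have h1 : ((M : Matrix (Fin n) (Fin n) R) *
        ((M⁻¹ : GL (Fin n) R) : Matrix (Fin n) (Fin n) R)) i i = 1 := by
      rw [← Units.val_mul]; simp
    rw [Matrix.mul_apply, Finset.sum_eq_single i, hM.2, one_mul] at h1
    · exact h1
    · intro k _ hk
      rcases lt_or_gt_of_ne hk with hk | hk
      · rw [hM.1 i k hk, zero_mul]
      · rw [hT k i hk, mul_zero]
    · simp

/-- The elementary matrix `E_{ij} = 1 + e_{ij}`, for `i < j`, as an element of `U_n(R)`. -/
def unipotentGroup.elem {n : ℕ} (R : Type*) [CommRing R] (i j : Fin n) (h : i < j) :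
    unipotentGroup n R :=
  ⟨⟨1 + Matrix.single i j 1, 1 - Matrix.single i j 1,
      by simp [mul_sub, add_mul, h.ne'], by simp [mul_add, sub_mul, h.ne']⟩,
    fun k l hkl => by
      have : ¬ (i = k ∧ j = l) := by rintro ⟨rfl, rfl⟩; exact absurd h hkl.not_gt
      simp [hkl.ne', this],
    fun k => by
      have : ¬ (i = k ∧ j = k) := by rintro ⟨rfl, h2⟩; exact h.ne' h2
      simp [this]⟩

namespace ArtinSchreier

variable (F : Type*) [Field F] [CharP F 2] (Fs : Type*) [Field Fs] [Algebra F Fs]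

instance (E : IntermediateField F Fs) : CharP E 2 :=
  charP_of_injective_algebraMap (algebraMap F E).injective 2

/-- The triples `(β, V, W)` consisting of a class `β` in `F / ℘(F)`, an `𝔽₂`-subspace `V` of
`F / ℘(F)` and, for `E = F(℘⁻¹(V))`, an `𝔽₂[Gal(E/F)]`-submodule `W` of `E / ℘(E)`. -/
@[ext]
structure Triple where
  β : ASQuot F
  V : Submodule (ZMod 2) (ASQuot F)
  W : Submodule (MonoidAlgebra (ZMod 2) Gal(rootField Fs (V : Set (ASQuot F))/F))
    (ASQuot (rootField Fs (V : Set (ASQuot F))))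

variable {F Fs}

namespace Triple

/-- The field `E = F(℘⁻¹(V))`. -/
abbrev E (t : Triple F Fs) : IntermediateField F Fs := rootField Fs (t.V : Set (ASQuot F))

/-- The field `L = E(℘⁻¹(W))`, as an extension of `F`. -/
def L (t : Triple F Fs) : IntermediateField F Fs :=
  (rootField Fs (t.W : Set (ASQuot t.E))).restrictScalars F

/-- Admissible triples: `V` has dimension `2`, the span of `V` and `β` has dimension `3`, and `W`
is a free `𝔽₂[Gal(E/F)]`-module generated by some `[δ]_E` such that `[Tr_{E/F}(δ)]_F = β`. -/
structure IsAdmissible (t : Triple F Fs) : Prop where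
  finrank_V : Module.finrank (ZMod 2) t.V = 2
  finrank_sup : Module.finrank (ZMod 2)
    (t.V ⊔ Submodule.span (ZMod 2) {t.β} : Submodule (ZMod 2) (ASQuot F)) = 3
  free : Module.Free (MonoidAlgebra (ZMod 2) Gal(t.E/F)) t.W
  exists_generator : ∃ δ : t.E,
    t.W = Submodule.span (MonoidAlgebra (ZMod 2) Gal(t.E/F)) {cls δ} ∧
    cls (Algebra.trace F t.E δ) = t.β

end Triple

/-- `L/F` is a Galois `U_4(𝔽₂)`-extension. -/
structure IsU4Extension (L : IntermediateField F Fs) : Prop where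
  finiteDimensional : FiniteDimensional F L
  isGalois : IsGalois F L
  nonempty_mulEquiv : Nonempty (Gal(L/F) ≃* unipotentGroup 4 (ZMod 2))

/-- The elements `a, b, c` of `F` are dual to `σ₁, σ₂, σ₃` with respect to the Artin-Schreier
pairing: there are roots `θ_a, θ_b, θ_c` in `L` of `X ^ 2 - X - a`, `X ^ 2 - X - b` and
`X ^ 2 - X - c` such that `σ₁` moves only `θ_a`, `σ₂` moves only `θ_b` and
`σ₃` moves only `θ_c`. -/
def IsDual (L : IntermediateField F Fs) (σ₁ σ₂ σ₃ : Gal(L/F)) (a b c : F) : Prop :=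
  ∃ θa θb θc : L,
    (θa ^ 2 - θa = algebraMap F L a ∧ θb ^ 2 - θb = algebraMap F L b ∧
      θc ^ 2 - θc = algebraMap F L c) ∧
    (σ₁ θa = θa + 1 ∧ σ₁ θb = θb ∧ σ₁ θc = θc) ∧
    (σ₂ θa = θa ∧ σ₂ θb = θb + 1 ∧ σ₂ θc = θc) ∧
    (σ₃ θa = θa ∧ σ₃ θb = θb ∧ σ₃ θc = θc + 1)

/-- The triple `t = (β, V, W)` is the one read off from `L` by means of the isomorphism
`ρ : Gal(L/F) ≃ U_4(𝔽₂)`: if `a, b, c` are dual to `ρ⁻¹(E₁₂), ρ⁻¹(E₂₃), ρ⁻¹(E₃₄)`, then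
`β = [b]_F`, `V = ⟨[a]_F, [c]_F⟩` and `W = (E ∩ ℘(L)) / ℘(E)` for `E = F(℘⁻¹(V))`. -/
def IsAssociated (L : IntermediateField F Fs) (ρ : Gal(L/F) ≃* unipotentGroup 4 (ZMod 2))
    (t : Triple F Fs) : Prop :=
  ∃ a b c : F,
    IsDual L (ρ.symm (unipotentGroup.elem (ZMod 2) 0 1 (by decide)))
      (ρ.symm (unipotentGroup.elem (ZMod 2) 1 2 (by decide)))
      (ρ.symm (unipotentGroup.elem (ZMod 2) 2 3 (by decide))) a b c ∧
    t.β = cls b ∧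
    t.V = Submodule.span (ZMod 2) {cls a, cls c} ∧
    ∀ e : t.E, cls e ∈ t.W ↔ ∃ θ ∈ L, θ ^ 2 - θ = (e : Fs)

end ArtinSchreier

end

/-! Both directions rest on one object, a frame (`IsFrame`). For a `U_4(𝔽₂)`-extension L with
isomorphism ρ, the sum of g(x) ρ(g⁻¹) over the Galois group, with Tr x = 1, is a unipotent matrix X
over L with s X = X ρ(s). Its entries A, B, C next to the diagonal are roots for a, b, c. Put Q =
x₁₃, P = x₀₂ + x₀₁x₁₂ and Y = x₀₃ + x₀₁x₁₃. If s translates A by i and C by j, then s sends ℘(Y) to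
℘(Y) + j℘(P) + i(℘(Q) + jb). Hence δ = ℘(Y) lies in E = F(A, C), its four conjugates add up to b,
and [δ] generates the span of the classes of δ, ℘(Q), ℘(P), b. The automorphisms over E translate B,
P, Q, Y independently by elements of 𝔽₂, so these four classes are independent. The module then has
at least 16 = |𝔽₂[Gal(E/F)]| elements, so it is free (`IsFrame.free_span`). By Artin-Schreier theory
over E it consists of exactly the classes with a root in L (`IsFrame.cls_mem_span_iff_exists`).

Conversely, let δ in E have trace b. Roots P, Q of differences of conjugates of δ and a root Y of δ
satisfy the frame relations for suitable constants in 𝔽₂, and composing automorphisms shows that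
these constants multiply like matrices (`exists_hom_of_relations`). The resulting r is onto the
abelianization because [a], [b], [c] are independent, so it is onto `U_4(𝔽₂)` by
`eq_top_of_surjective`; the field E(℘⁻¹(W)) is the one cut out by ker r.

The triple does not depend on ρ because of two facts about automorphisms of `U_4(𝔽₂)`: they preserve
the centralizer of the commutators, given by M₀₁ = M₂₃ = 0, which fixes V
(`entries_map_eq_zero_iff`), and they preserve the character M₁₂, which fixes β
(`entry_one_two_map`). Since W is the set of classes with a root in L, a field has only one
associated triple, whence injectivity. -/

noncomputable section

/-! ### Coordinates on `U_4` -/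

namespace unipotentGroup

/-- The `(i, j)` entry of a unipotent matrix. -/
def entry {n : ℕ} {R : Type*} [CommRing R] (M : unipotentGroup n R) (i j : Fin n) : R :=
  ((M : GL (Fin n) R) : Matrix (Fin n) (Fin n) R) i j

section Entries

variable {R : Type*} [CommRing R]

theorem entry_of_lt {n : ℕ} (M : unipotentGroup n R) {i j : Fin n} (h : j < i) :
    entry M i j = 0 := M.2.1 i j h

theorem entry_diag {n : ℕ} (M : unipotentGroup n R) (i : Fin n) : entry M i i = 1 := M.2.2 i

theorem entry_mul {n : ℕ} (M N : unipotentGroup n R) (i j : Fin n) :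
    entry (M * N) i j = ∑ k, entry M i k * entry N k j := by
  simp [entry, Matrix.mul_apply]

theorem ext_entry {n : ℕ} {M N : unipotentGroup n R}
    (h : ∀ i j, i < j → entry M i j = entry N i j) : M = N := by
  refine Subtype.ext (Units.ext (Matrix.ext fun i j => ?_))
  rcases lt_trichotomy i j with hij | rfl | hij
  · exact h i j hij
  · exact (entry_diag M i).trans (entry_diag N i).symm
  · exact (entry_of_lt M hij).trans (entry_of_lt N hij).symm

variable (M N : unipotentGroup 4 R)

theorem ext_four {M N : unipotentGroup 4 R} (h01 : entry M 0 1 = entry N 0 1)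
    (h12 : entry M 1 2 = entry N 1 2) (h23 : entry M 2 3 = entry N 2 3)
    (h02 : entry M 0 2 = entry N 0 2) (h13 : entry M 1 3 = entry N 1 3)
    (h03 : entry M 0 3 = entry N 0 3) : M = N := by
  refine ext_entry fun i j hij => ?_
  fin_cases i <;> fin_cases j <;> first | assumption | exact absurd hij (by decide)

@[simp] theorem mul_entry_zero_one : entry (M * N) 0 1 = entry M 0 1 + entry N 0 1 := by
  rw [entry_mul, Fin.sum_univ_four, entry_diag, entry_diag,
    entry_of_lt N (show (1 : Fin 4) < 2 by decide),
    entry_of_lt N (show (1 : Fin 4) < 3 by decide)]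
  ring

@[simp] theorem mul_entry_one_two : entry (M * N) 1 2 = entry M 1 2 + entry N 1 2 := by
  rw [entry_mul, Fin.sum_univ_four, entry_diag, entry_diag,
    entry_of_lt M (show (0 : Fin 4) < 1 by decide),
    entry_of_lt N (show (2 : Fin 4) < 3 by decide)]
  ring

@[simp] theorem mul_entry_two_three : entry (M * N) 2 3 = entry M 2 3 + entry N 2 3 := by
  rw [entry_mul, Fin.sum_univ_four, entry_diag, entry_diag,
    entry_of_lt M (show (0 : Fin 4) < 2 by decide),
    entry_of_lt M (show (1 : Fin 4) < 2 by decide)]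
  ring

@[simp] theorem mul_entry_zero_two :
    entry (M * N) 0 2 = entry M 0 2 + entry M 0 1 * entry N 1 2 + entry N 0 2 := by
  rw [entry_mul, Fin.sum_univ_four, entry_diag, entry_diag,
    entry_of_lt N (show (2 : Fin 4) < 3 by decide)]
  ring

@[simp] theorem mul_entry_one_three :
    entry (M * N) 1 3 = entry M 1 3 + entry M 1 2 * entry N 2 3 + entry N 1 3 := by
  rw [entry_mul, Fin.sum_univ_four, entry_diag, entry_diag,
    entry_of_lt M (show (0 : Fin 4) < 1 by decide)]
  ring

@[simp] theorem mul_entry_zero_three :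
    entry (M * N) 0 3 = entry M 0 3 + entry M 0 2 * entry N 2 3 + entry M 0 1 * entry N 1 3 +
      entry N 0 3 := by
  rw [entry_mul, Fin.sum_univ_four, entry_diag, entry_diag]
  ring

@[simp] theorem one_entry (i j : Fin 4) :
    entry (1 : unipotentGroup 4 R) i j = if i = j then 1 else 0 := by
  simp [entry, Matrix.one_apply]

theorem elem_entry (i j : Fin 4) (h : i < j) (k l : Fin 4) :
    entry (elem R i j h) k l = (if k = l then 1 else 0) + (if i = k ∧ j = l then 1 else 0) := by
  simp [entry, elem, Matrix.one_apply, Matrix.single_apply]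

/-- The unipotent matrix with the six given entries above the diagonal. -/
def ofEntries (x01 x12 x23 x02 x13 x03 : R) : unipotentGroup 4 R :=
  ⟨⟨!![1, x01, x02, x03; 0, 1, x12, x13; 0, 0, 1, x23; 0, 0, 0, 1],
    !![1, -x01, x01 * x12 - x02, x01 * x13 + x02 * x23 - x01 * x12 * x23 - x03;
      0, 1, -x12, x12 * x23 - x13; 0, 0, 1, -x23; 0, 0, 0, 1],
    by
      ext i j
      fin_cases i <;> fin_cases j <;> simp [Matrix.mul_apply, Fin.sum_univ_four] <;> ring,
    by
      ext i j
      fin_cases i <;> fin_cases j <;> simp [Matrix.mul_apply, Fin.sum_univ_four] <;> ring⟩,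
    fun i j h => by
      fin_cases i <;> fin_cases j <;> first | rfl | exact absurd h (by decide),
    fun i => by fin_cases i <;> rfl⟩

section ofEntries

variable (x01 x12 x23 x02 x13 x03 : R)

@[simp] theorem ofEntries_entry_zero_one :
    entry (ofEntries x01 x12 x23 x02 x13 x03) 0 1 = x01 := rfl
@[simp] theorem ofEntries_entry_one_two :
    entry (ofEntries x01 x12 x23 x02 x13 x03) 1 2 = x12 := rfl
@[simp] theorem ofEntries_entry_two_three :
    entry (ofEntries x01 x12 x23 x02 x13 x03) 2 3 = x23 := rfl
@[simp] theorem ofEntries_entry_zero_two :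
    entry (ofEntries x01 x12 x23 x02 x13 x03) 0 2 = x02 := rfl
@[simp] theorem ofEntries_entry_one_three :
    entry (ofEntries x01 x12 x23 x02 x13 x03) 1 3 = x13 := rfl
@[simp] theorem ofEntries_entry_zero_three :
    entry (ofEntries x01 x12 x23 x02 x13 x03) 0 3 = x03 := rfl

end ofEntries

theorem elem_zero_one : elem R (0 : Fin 4) 1 (by decide) = ofEntries 1 0 0 0 0 0 := by
  apply ext_four <;> simp [elem_entry]

theorem elem_one_two : elem R (1 : Fin 4) 2 (by decide) = ofEntries 0 1 0 0 0 0 := by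
  apply ext_four <;> simp [elem_entry]

theorem elem_two_three : elem R (2 : Fin 4) 3 (by decide) = ofEntries 0 0 1 0 0 0 := by
  apply ext_four <;> simp [elem_entry]

end Entries

/-! ### Generators, characters and automorphisms of `U_4(𝔽₂)` -/

section Generation

theorem zmod_two_cases (x : ZMod 2) : x = 0 ∨ x = 1 := by
  revert x; decide

theorem entry_inv_zero_one {R : Type*} [CommRing R] (M : unipotentGroup 4 R) :
    entry M⁻¹ 0 1 = -entry M 0 1 := by
  have := mul_entry_zero_one M M⁻¹
  simp at this
  linear_combination -this

theorem entry_inv_one_two {R : Type*} [CommRing R] (M : unipotentGroup 4 R) :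
    entry M⁻¹ 1 2 = -entry M 1 2 := by
  have := mul_entry_one_two M M⁻¹
  simp at this
  linear_combination -this

theorem entry_inv_two_three {R : Type*} [CommRing R] (M : unipotentGroup 4 R) :
    entry M⁻¹ 2 3 = -entry M 2 3 := by
  have := mul_entry_two_three M M⁻¹
  simp at this
  linear_combination -this

/-- A subgroup of `U_4(𝔽₂)` that surjects onto the abelianization is the whole group. -/
theorem eq_top_of_surjective (H : Subgroup (unipotentGroup 4 (ZMod 2)))
    (h1 : ∃ M ∈ H, entry M 0 1 = 1 ∧ entry M 1 2 = 0 ∧ entry M 2 3 = 0)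
    (h2 : ∃ M ∈ H, entry M 0 1 = 0 ∧ entry M 1 2 = 1 ∧ entry M 2 3 = 0)
    (h3 : ∃ M ∈ H, entry M 0 1 = 0 ∧ entry M 1 2 = 0 ∧ entry M 2 3 = 1) : H = ⊤ := by
  obtain ⟨M1, hM1, a1, b1, c1⟩ := h1
  obtain ⟨M2, hM2, a2, b2, c2⟩ := h2
  obtain ⟨M3, hM3, a3, b3, c3⟩ := h3
  have comm : ∀ {M N K : unipotentGroup 4 (ZMod 2)}, M ∈ H → N ∈ H →
      M * N = K * (N * M) → K ∈ H := by
    intro M N K hM hN h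
    rw [← mul_inv_eq_iff_eq_mul] at h
    exact h ▸ H.mul_mem (H.mul_mem hM hN) (H.inv_mem (H.mul_mem hN hM))
  have key : ∀ {M : unipotentGroup 4 (ZMod 2)}, (∃ N ∈ H, ∃ K ∈ H, M = N * K) → M ∈ H := by
    rintro M ⟨N, hN, K, hK, rfl⟩
    exact H.mul_mem hN hK
  -- The second layer of the lower central series is reached by commutators, which are bilinear in
  -- the entries next to the diagonal.
  have comm_entries : ∀ M N : unipotentGroup 4 (ZMod 2), M ∈ H → N ∈ H →
      ∃ K ∈ H, entry K 0 1 = 0 ∧ entry K 1 2 = 0 ∧ entry K 2 3 = 0 ∧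
        entry K 0 2 = entry M 0 1 * entry N 1 2 - entry N 0 1 * entry M 1 2 ∧
        entry K 1 3 = entry M 1 2 * entry N 2 3 - entry N 1 2 * entry M 2 3 := by
    intro M N hM hN
    refine ⟨M * N * (N * M)⁻¹, H.mul_mem (H.mul_mem hM hN) (H.inv_mem (H.mul_mem hN hM)), ?_⟩
    set K := M * N * (N * M)⁻¹ with hK
    have hK' : K * (N * M) = M * N := by rw [hK]; group
    have e1 := congrArg (entry · 0 1) hK'
    have e2 := congrArg (entry · 1 2) hK'
    have e3 := congrArg (entry · 2 3) hK'
    have e4 := congrArg (entry · 0 2) hK'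
    have e5 := congrArg (entry · 1 3) hK'
    simp only [mul_entry_zero_one, mul_entry_one_two, mul_entry_two_three, mul_entry_zero_two,
      mul_entry_one_three] at e1 e2 e3 e4 e5
    grind
  obtain ⟨N, hN, n1, n2, n3, n4, n5⟩ := comm_entries M1 M2 hM1 hM2
  obtain ⟨N', hN', n1', n2', n3', n4', n5'⟩ := comm_entries M2 M3 hM2 hM3
  simp only [a1, b1, c1, a2, b2, c2] at n4 n5
  simp only [a3, b3, c3, a2, b2, c2] at n4' n5'
  -- `N` is [M1, M2], with entries 1 at (0,2) and 0 at (1,3); its commutator with M3 generates the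
  -- centre. The rest climbs back: once a layer lies in `H`, membership depends only on the entries
  -- above that layer.
  have z : ofEntries 0 0 0 0 0 1 ∈ H := by
    refine comm hN hM3 ?_
    apply ext_four <;> simp [n1, n2, n3, n4, n5, a3, b3, c3] <;> ring
  have of_one : ∀ {f : ZMod 2 → unipotentGroup 4 (ZMod 2)}, f 0 = 1 → f 1 ∈ H → ∀ x, f x ∈ H := by
    intro f h0 h1 x
    rcases zmod_two_cases x with rfl | rfl
    · exact h0 ▸ H.one_mem
    · exact h1
  have one_eq : ofEntries 0 0 0 0 0 0 = (1 : unipotentGroup 4 (ZMod 2)) := by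
    apply ext_four <;> simp
  have zz : ∀ x, ofEntries 0 0 0 0 0 x ∈ H := of_one one_eq z
  have up : ∀ {M N : unipotentGroup 4 (ZMod 2)}, N ∈ H → entry M 0 1 = entry N 0 1 →
      entry M 1 2 = entry N 1 2 → entry M 2 3 = entry N 2 3 → entry M 0 2 = entry N 0 2 →
      entry M 1 3 = entry N 1 3 → M ∈ H := by
    intro M N hN h1 h2 h3 h4 h5
    refine key ⟨N, hN, _, zz (entry M 0 3 - entry N 0 3), ?_⟩
    apply ext_four <;> simp [*]
  have e02 : ∀ x, ofEntries 0 0 0 x 0 0 ∈ H :=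
    of_one one_eq (up hN (by simp [*]) (by simp [*]) (by simp [*]) (by simp [*]) (by simp [*]))
  have e13 : ∀ x, ofEntries 0 0 0 0 x 0 ∈ H :=
    of_one one_eq (up hN' (by simp [*]) (by simp [*]) (by simp [*]) (by simp [*]) (by simp [*]))
  have up' : ∀ {M N : unipotentGroup 4 (ZMod 2)}, N ∈ H → entry M 0 1 = entry N 0 1 →
      entry M 1 2 = entry N 1 2 → entry M 2 3 = entry N 2 3 → M ∈ H := by
    intro M N hN h1 h2 h3
    refine up (H.mul_mem hN (H.mul_mem (e02 (entry M 0 2 - entry N 0 2))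
      (e13 (entry M 1 3 - entry N 1 3)))) ?_ ?_ ?_ ?_ ?_ <;> simp [*]
  have e01 : ∀ x, ofEntries x 0 0 0 0 0 ∈ H :=
    of_one one_eq (up' hM1 (by simp [*]) (by simp [*]) (by simp [*]))
  have e12 : ∀ x, ofEntries 0 x 0 0 0 0 ∈ H :=
    of_one one_eq (up' hM2 (by simp [*]) (by simp [*]) (by simp [*]))
  have e23 : ∀ x, ofEntries 0 0 x 0 0 0 ∈ H :=
    of_one one_eq (up' hM3 (by simp [*]) (by simp [*]) (by simp [*]))
  refine eq_top_iff.2 fun M _ => up' (H.mul_mem (e01 (entry M 0 1)) (H.mul_mem (e12 (entry M 1 2))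
    (e23 (entry M 2 3)))) ?_ ?_ ?_ <;> simp

theorem entry_commutator {M N K : unipotentGroup 4 (ZMod 2)} (h : K * (N * M) = M * N) :
    entry K 0 1 = 0 ∧ entry K 1 2 = 0 ∧ entry K 2 3 = 0 := by
  have e1 := congrArg (entry · 0 1) h
  have e2 := congrArg (entry · 1 2) h
  have e3 := congrArg (entry · 2 3) h
  simp only [mul_entry_zero_one, mul_entry_one_two, mul_entry_two_three] at e1 e2 e3
  grind

/-- The subgroup of matrices `M` with `M₀₁ = M₂₃ = 0` is the centralizer of the commutators. -/
theorem entries_eq_zero_iff (M : unipotentGroup 4 (ZMod 2)) :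
    entry M 0 1 = 0 ∧ entry M 2 3 = 0 ↔
      ∀ N N' K : unipotentGroup 4 (ZMod 2), K * (N * N') = N' * N → M * K = K * M := by
  constructor
  · rintro ⟨h1, h2⟩ N N' K h
    obtain ⟨k1, k2, k3⟩ := entry_commutator h
    apply ext_four <;> simp [*] <;> ring
  · intro h
    -- Commuting with the commutator that has its only entry at (0,2) forces M₂₃ = 0; the one with
    -- its only entry at (1,3) forces M₀₁ = 0.
    have e1 := congrArg (entry · 0 3) (h (ofEntries 1 0 0 0 0 0) (ofEntries 0 1 0 0 0 0)
      (ofEntries 0 0 0 1 0 0)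
      (by apply ext_four <;> simp [CharTwo.add_self_eq_zero]))
    have e2 := congrArg (entry · 0 3) (h (ofEntries 0 1 0 0 0 0) (ofEntries 0 0 1 0 0 0)
      (ofEntries 0 0 0 0 1 0)
      (by apply ext_four <;> simp [CharTwo.add_self_eq_zero]))
    simp at e1 e2
    grind

/-- The centralizer of the commutators is defined by the group structure alone. -/
theorem entries_map_eq_zero_iff (α : unipotentGroup 4 (ZMod 2) ≃* unipotentGroup 4 (ZMod 2))
    (M : unipotentGroup 4 (ZMod 2)) :
    entry (α M) 0 1 = 0 ∧ entry (α M) 2 3 = 0 ↔ entry M 0 1 = 0 ∧ entry M 2 3 = 0 := by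
  rw [entries_eq_zero_iff, entries_eq_zero_iff]
  constructor
  · intro h N N' K hK
    apply α.injective
    simpa only [map_mul] using h (α N) (α N') (α K) (by simp only [← map_mul, hK])
  · intro h N N' K hK
    apply α.symm.injective
    simpa only [map_mul, α.symm_apply_apply] using h (α.symm N) (α.symm N') (α.symm K)
      (by simp only [← map_mul, hK])

/-- Every character of `U_4(𝔽₂)` is a combination of the three entries next to the diagonal. -/
theorem character_eq (φ : unipotentGroup 4 (ZMod 2) → ZMod 2)
    (hφ : ∀ M N, φ (M * N) = φ M + φ N) (M : unipotentGroup 4 (ZMod 2)) :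
    φ M = φ (ofEntries 1 0 0 0 0 0) * entry M 0 1 + φ (ofEntries 0 1 0 0 0 0) * entry M 1 2 +
      φ (ofEntries 0 0 1 0 0 0) * entry M 2 3 := by
  have h1 : φ 1 = 0 := by simpa using hφ 1 1
  let H : Subgroup (unipotentGroup 4 (ZMod 2)) :=
    { carrier := {M | φ M = φ (ofEntries 1 0 0 0 0 0) * entry M 0 1 +
        φ (ofEntries 0 1 0 0 0 0) * entry M 1 2 + φ (ofEntries 0 0 1 0 0 0) * entry M 2 3}
      one_mem' := by simp [h1]
      mul_mem' := by
        intro N N' h h'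
        simp only [Set.mem_ofPred_eq] at h h' ⊢
        rw [hφ, h, h', mul_entry_zero_one, mul_entry_one_two, mul_entry_two_three]
        ring
      inv_mem' := by
        intro N h
        simp only [Set.mem_ofPred_eq] at h ⊢
        have := hφ N N⁻¹
        rw [mul_inv_cancel, h1, h] at this
        rw [entry_inv_zero_one, entry_inv_one_two, entry_inv_two_three]
        linear_combination -this }
  have : H = ⊤ := eq_top_of_surjective H ⟨ofEntries 1 0 0 0 0 0, by simp [H], by simp⟩
    ⟨ofEntries 0 1 0 0 0 0, by simp [H], by simp⟩ ⟨ofEntries 0 0 1 0 0 0, by simp [H], by simp⟩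
  exact (this ▸ Subgroup.mem_top M : M ∈ H)

/-- The character `M ↦ M₁₂` of `U_4(𝔽₂)` is invariant under all automorphisms. -/
theorem entry_one_two_map (α : unipotentGroup 4 (ZMod 2) ≃* unipotentGroup 4 (ZMod 2))
    (M : unipotentGroup 4 (ZMod 2)) : entry (α M) 1 2 = entry M 1 2 := by
  -- The (0,2) and (1,3) entries of N² are N₀₁N₁₂ and N₁₂N₂₃, so an involution with N₀₁ or N₂₃
  -- nonzero has N₁₂ = 0. This applies to the images under α of the generators E₁₂ and E₃₄.
  have inv : ∀ N : unipotentGroup 4 (ZMod 2), N * N = 1 → ¬ (entry N 0 1 = 0 ∧ entry N 2 3 = 0) →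
      entry (α N) 1 2 = 0 := by
    intro N hN h
    rw [← entries_map_eq_zero_iff α] at h
    have h2 : α N * α N = 1 := by rw [← map_mul, hN, map_one]
    have e1 := congrArg (entry · 0 2) h2
    have e2 := congrArg (entry · 1 3) h2
    simp [add_right_comm _ _ (entry (α N) _ _), CharTwo.add_self_eq_zero] at e1 e2
    grind
  have h1 : entry (α (ofEntries 1 0 0 0 0 0)) 1 2 = 0 :=
    inv _ (by apply ext_four <;> simp [CharTwo.add_self_eq_zero]) (by simp)
  have h3 : entry (α (ofEntries 0 0 1 0 0 0)) 1 2 = 0 :=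
    inv _ (by apply ext_four <;> simp [CharTwo.add_self_eq_zero]) (by simp)
  have key := fun N => character_eq (fun M => entry (α M) 1 2) (fun _ _ => by simp) N
  simp only [h1, h3, zero_mul, zero_add, add_zero] at key
  rcases zmod_two_cases (entry (α (ofEntries 0 1 0 0 0 0)) 1 2) with h | h
  -- If the remaining coefficient vanished, M₁₂ would be zero on the image of α, which is
  -- everything.
  · have := key (α.symm (ofEntries 0 1 0 0 0 0))
    simp [h] at this
  · simpa [h] using key M

/-- The preserved subgroup M₀₁ = M₂₃ = 0 contains E₂₃, so φ ∘ α vanishes there and the middle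
coefficient in `character_eq` drops out. -/
theorem exists_character_map_eq
    (α : unipotentGroup 4 (ZMod 2) ≃* unipotentGroup 4 (ZMod 2))
    {φ : unipotentGroup 4 (ZMod 2) → ZMod 2} (hφ : ∀ M N, φ (M * N) = φ M + φ N)
    (h0 : ∀ M, entry M 0 1 = 0 → entry M 2 3 = 0 → φ M = 0) :
    ∃ x z, ∀ M, φ (α M) = x * entry M 0 1 + z * entry M 2 3 := by
  refine ⟨φ (α (ofEntries 1 0 0 0 0 0)), φ (α (ofEntries 0 0 1 0 0 0)), fun M =>
    (character_eq (fun M => φ (α M)) (fun _ _ => by rw [map_mul, hφ]) M).trans ?_⟩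
  have h := (entries_map_eq_zero_iff α (ofEntries 0 1 0 0 0 0)).2 (by simp)
  rw [h0 _ h.1 h.2, zero_mul, add_zero]

end Generation

end unipotentGroup

namespace ArtinSchreier

set_option linter.unusedSectionVars false

/-! ### Constants from `𝔽₂` and differences of Artin-Schreier roots -/

section PrimeField

variable (K : Type*) [Field K] [CharP K 2]

/-- The embedding of `𝔽₂` into a field of characteristic `2`. -/
def incl : ZMod 2 →+* K := ZMod.castHom (dvd_refl 2) K

variable {K}

theorem incl_injective : Function.Injective (incl K) := (incl K).injective

theorem incl_sq (n : ZMod 2) : incl K n ^ 2 = incl K n := by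
  rcases unipotentGroup.zmod_two_cases n with rfl | rfl <;> simp

theorem exists_incl_eq {x : K} (h : x ^ 2 - x = 0) : ∃ n, x = incl K n := by
  have : x * (x - 1) = 0 := by linear_combination h
  rcases mul_eq_zero.1 this with h | h
  · exact ⟨0, by simp [h]⟩
  · exact ⟨1, by simp [sub_eq_zero.1 h]⟩

theorem exists_eq_add_incl {x y : K} (h : x ^ 2 - x = y ^ 2 - y) : ∃ n, x = y + incl K n := by
  have h2 : (2 : K) = 0 := CharTwo.two_eq_zero
  obtain ⟨n, hn⟩ := exists_incl_eq (x := x - y) (by linear_combination h + (y ^ 2 - x * y) * h2)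
  exact ⟨n, by rw [← hn]; ring⟩

theorem add_sq_sub (x y : K) : (x + y) ^ 2 - (x + y) = (x ^ 2 - x) + (y ^ 2 - y) := by
  rw [CharTwo.add_sq]; ring

theorem incl_mul_sq_sub (n : ZMod 2) (x : K) :
    (incl K n * x) ^ 2 - incl K n * x = incl K n * (x ^ 2 - x) := by
  rw [mul_pow, incl_sq]; ring

theorem incl_sq_sub (n : ZMod 2) : incl K n ^ 2 - incl K n = 0 := by rw [incl_sq, sub_self]

theorem map_incl {K' : Type*} [Field K'] [CharP K' 2] (f : K →+* K') (n : ZMod 2) :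
    f (incl K n) = incl K' n := by
  rcases unipotentGroup.zmod_two_cases n with rfl | rfl <;> simp

theorem algEquiv_incl {F : Type*} [Field F] [Algebra F K] (s : Gal(K/F)) (n : ZMod 2) :
    s (incl K n) = incl K n := map_incl (s : K →+* K) n

theorem cls_eq_cls_iff (x y : K) : cls x = cls y ↔ ∃ z : K, x = y + (z ^ 2 - z) := by
  rw [← sub_eq_zero, ← map_sub, cls_eq_zero_iff]
  simp only [eq_sub_iff_add_eq, eq_comm (b := x), add_comm y]

theorem smul_cls (n : ZMod 2) (x : K) : n • (cls x : ASQuot K) = cls (incl K n * x) := by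
  rcases unipotentGroup.zmod_two_cases n with rfl | rfl <;> simp

end PrimeField

variable {F : Type*} [Field F] [CharP F 2] {Fs : Type*} [Field Fs] [Algebra F Fs]

/-! ### Galois action on Artin-Schreier roots -/

section Basic

theorem mem_rootField {K Ω : Type*} [Field K] [CharP K 2] [Field Ω] [Algebra K Ω]
    {S : Set (ASQuot K)} {a : K} (ha : cls a ∈ S) {θ : Ω} (hθ : θ ^ 2 - θ = algebraMap K Ω a) :
    θ ∈ rootField Ω S :=
  IntermediateField.subset_adjoin _ _ ⟨a, ha, hθ⟩

theorem forall_mem_rootField {K Ω : Type*} [Field K] [CharP K 2] [Field Ω] [Algebra K Ω]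
    {S : Set (ASQuot K)} {s : Gal(Ω/K)}
    (h : ∀ (θ : Ω) (a : K), cls a ∈ S → θ ^ 2 - θ = algebraMap K Ω a → s θ = θ) :
    ∀ x ∈ rootField Ω S, s x = x := by
  have : rootField Ω S ≤ IntermediateField.fixedField (Subgroup.zpowers s) := by
    refine IntermediateField.adjoin_le_iff.2 ?_
    rintro θ ⟨a, ha, hθ⟩
    have hs : Subgroup.zpowers s ≤ MulAction.stabilizer Gal(Ω/K) θ := by
      rw [Subgroup.zpowers_le]
      exact h θ a ha hθ
    exact fun g => hs g.2
  intro x hx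
  exact this hx ⟨s, Subgroup.mem_zpowers s⟩

variable [IsSepClosure F Fs]

theorem mem_of_forall_fixed (E : IntermediateField F Fs) {x : Fs}
    (h : ∀ s : Gal(Fs/F), (∀ y ∈ E, s y = y) → s x = x) : x ∈ E := by
  rw [← InfiniteGalois.fixedField_fixingSubgroup E, IntermediateField.mem_fixedField_iff]
  intro s hs
  exact h s fun y hy => hs ⟨y, hy⟩

theorem exists_algebraMap_eq {x : Fs} (h : ∀ s : Gal(Fs/F), s x = x) :
    ∃ a : F, algebraMap F Fs a = x :=
  (InfiniteGalois.mem_range_algebraMap_iff_fixed x).2 h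

variable [CharP Fs 2]

/-- The polynomial X² - X - x has derivative -1 in characteristic 2, so it is separable. -/
theorem exists_root (F : Type*) [Field F] {Fs : Type*} [Field Fs] [Algebra F Fs]
    [IsSepClosure F Fs] [CharP Fs 2] (x : Fs) : ∃ y : Fs, y ^ 2 - y = x := by
  have := IsSepClosure.sep_closed F (K := Fs)
  obtain ⟨y, hy⟩ := IsSepClosed.exists_root_C_mul_X_pow_add_C_mul_X_add_C' 2 2 (1 : Fs) (-1) (-x)
    dvd_rfl le_rfl (by simp)
  exact ⟨y, by linear_combination hy⟩

theorem exists_map_eq_add {A : Fs} {a : F} (hA : A ^ 2 - A = algebraMap F Fs a) (s : Gal(Fs/F)) :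
    ∃ n, s A = A + incl Fs n :=
  exists_eq_add_incl (by rw [hA, ← map_pow, ← map_sub, hA, AlgEquiv.commutes])

/-- If the classes of `a i` are linearly independent, the Galois group acts on the roots
in all possible ways. -/
theorem exists_map_eq_of_linearIndependent {n : ℕ} (a : Fin n → F) (A : Fin n → Fs)
    (hA : ∀ i, A i ^ 2 - A i = algebraMap F Fs (a i))
    (h : LinearIndependent (ZMod 2) fun i => (cls (a i) : ASQuot F)) (x : Fin n → ZMod 2) :
    ∃ s : Gal(Fs/F), ∀ i, s (A i) = A i + incl Fs (x i) := by
  choose χ hχ using fun (s : Gal(Fs/F)) i => exists_map_eq_add (hA i) s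
  have hmul : ∀ s t, χ (s * t) = χ s + χ t := by
    intro s t
    funext i
    apply incl_injective (K := Fs)
    have := hχ (s * t) i
    rw [AlgEquiv.mul_apply, hχ t, map_add, hχ s, algEquiv_incl] at this
    simp only [Pi.add_apply, map_add]
    linear_combination -this
  have hone : χ 1 = 0 := by simpa using hmul 1 1
  let T : AddSubgroup (Fin n → ZMod 2) :=
    { carrier := Set.range χ
      zero_mem' := ⟨1, hone⟩
      add_mem' := by
        rintro _ _ ⟨s, rfl⟩ ⟨t, rfl⟩
        exact ⟨s * t, hmul s t⟩
      neg_mem' := by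
        rintro _ ⟨s, rfl⟩
        refine ⟨s⁻¹, ?_⟩
        have := hmul s s⁻¹
        rw [mul_inv_cancel, hone] at this
        exact (neg_eq_of_add_eq_zero_right this.symm).symm }
  let S : Submodule (ZMod 2) (Fin n → ZMod 2) := AddSubgroup.toZModSubmodule 2 T
  have hS : S = ⊤ := by
    -- A proper subspace is killed by a nonzero functional f. Then the sum of the f_i A_i is Galois
    -- invariant, hence lies in F, and applying ℘ gives a nontrivial relation among the classes.
    by_contra hne
    obtain ⟨f, hf, hle⟩ := Submodule.exists_le_ker_of_lt_top S (lt_top_iff_ne_top.2 hne)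
    have hfχ : ∀ s, ∑ i, f (Pi.single i 1) * χ s i = 0 := by
      intro s
      have h0 : f (χ s) = 0 := hle (show χ s ∈ T from ⟨s, rfl⟩)
      rw [← h0, LinearMap.pi_apply_eq_sum_univ f (χ s)]
      refine Finset.sum_congr rfl fun i _ => ?_
      rw [smul_eq_mul, mul_comm]
      congr 2
      funext j
      simp [Pi.single_apply, eq_comm]
    obtain ⟨z, hz⟩ := exists_algebraMap_eq (F := F)
      (x := ∑ i, incl Fs (f (Pi.single i 1)) * A i) (by
        intro s
        have h0 := congrArg (incl Fs) (hfχ s)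
        simp only [map_sum, map_mul, map_zero] at h0
        simp only [map_sum, map_mul, algEquiv_incl, hχ s, mul_add, Finset.sum_add_distrib, h0,
          add_zero])
    have hz' : z ^ 2 - z = ∑ i, incl F (f (Pi.single i 1)) * a i := by
      apply (algebraMap F Fs).injective
      rw [map_sub, map_pow, hz, map_sum]
      change wp Fs _ = _
      rw [map_sum]
      refine Finset.sum_congr rfl fun i _ => ?_
      change (_ ^ 2 - _ : Fs) = _
      rw [incl_mul_sq_sub, hA, map_mul, map_incl]
    have h0 : ∑ i, f (Pi.single i 1) • (cls (a i) : ASQuot F) = 0 := by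
      simp only [smul_cls, ← map_sum]
      exact (cls_eq_zero_iff _).2 ⟨z, hz'⟩
    have h1 := Fintype.linearIndependent_iff.1 h _ h0
    apply hf
    apply LinearMap.pi_ext'
    intro i
    ext
    simpa using h1 i
  obtain ⟨s, hs⟩ : x ∈ T := by
    have : x ∈ S := hS ▸ Submodule.mem_top
    exact this
  exact ⟨s, fun i => by rw [hχ, hs]⟩

/-- If the Galois group acts on the roots in all possible ways, the classes are linearly
independent. -/
theorem linearIndependent_of_exists_map_eq {n : ℕ} (a : Fin n → F) (A : Fin n → Fs)
    (hA : ∀ i, A i ^ 2 - A i = algebraMap F Fs (a i))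
    (h : ∀ i, ∃ s : Gal(Fs/F), ∀ j, s (A j) = A j + incl Fs ((Pi.single i 1 : Fin n → ZMod 2) j)) :
    LinearIndependent (ZMod 2) fun i => (cls (a i) : ASQuot F) := by
  rw [Fintype.linearIndependent_iff]
  intro g hg i
  simp only [smul_cls, ← map_sum] at hg
  obtain ⟨y, hy⟩ := (cls_eq_zero_iff _).1 hg
  have h0 : (∑ j, incl Fs (g j) * A j) ^ 2 - ∑ j, incl Fs (g j) * A j =
      algebraMap F Fs y ^ 2 - algebraMap F Fs y := by
    rw [← map_pow, ← map_sub, hy, map_sum]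
    change wp Fs _ = _
    rw [map_sum]
    refine Finset.sum_congr rfl fun i _ => ?_
    change (_ ^ 2 - _ : Fs) = _
    rw [incl_mul_sq_sub, hA, map_mul, map_incl]
  -- A relation puts the sum of the g_j A_j into F; the automorphism that moves only A_i then shows
  -- g_i = 0.
  obtain ⟨m, hm⟩ := exists_eq_add_incl h0
  obtain ⟨s, hs⟩ := h i
  have h1 := congrArg s hm
  rw [map_add, AlgEquiv.commutes, algEquiv_incl, ← hm, map_sum] at h1
  simp only [map_mul, algEquiv_incl, hs, mul_add, Finset.sum_add_distrib, add_eq_left] at h1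
  simp only [← map_mul, ← map_sum, map_eq_zero] at h1
  simpa [Pi.single_apply] using h1

end Basic

end ArtinSchreier

/-! ### The field E = F(A, C) and its group of order four -/

namespace ArtinSchreier

set_option linter.unusedSectionVars false

variable {F : Type*} [Field F] [CharP F 2] {Fs : Type*} [Field Fs] [Algebra F Fs]
  [IsSepClosure F Fs] [CharP Fs 2]

/-- `V` is spanned by the classes of `a` and `c`, which have the roots `A` and `C`, and the Galois
group acts on `A` and `C` in all four possible ways. -/
structure IsRootPair (V : Submodule (ZMod 2) (ASQuot F)) (a c : F) (A C : Fs) : Prop where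
  span_eq : V = Submodule.span (ZMod 2) {cls a, cls c}
  root_left : A ^ 2 - A = algebraMap F Fs a
  root_right : C ^ 2 - C = algebraMap F Fs c
  exists_map_eq : ∀ i j : ZMod 2, ∃ s : Gal(Fs/F), s A = A + incl Fs i ∧ s C = C + incl Fs j

namespace IsRootPair

variable {V : Submodule (ZMod 2) (ASQuot F)} {a c : F} {A C : Fs} (h : IsRootPair V a c A C)
include h

theorem left_mem : A ∈ rootField Fs (V : Set (ASQuot F)) :=
  mem_rootField (by rw [h.span_eq]; exact Submodule.subset_span (by simp)) h.root_left

theorem right_mem : C ∈ rootField Fs (V : Set (ASQuot F)) :=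
  mem_rootField (by rw [h.span_eq]; exact Submodule.subset_span (by simp)) h.root_right

/-- Each generator θ of the field is a combination of A and C plus an element of F, up to a constant
in 𝔽₂. -/
theorem forall_fixed {s : Gal(Fs/F)} (hA : s A = A) (hC : s C = C) :
    ∀ x ∈ rootField Fs (V : Set (ASQuot F)), s x = x := by
  refine forall_mem_rootField fun θ d hd hθ => ?_
  rw [h.span_eq, SetLike.mem_coe, Submodule.mem_span_pair] at hd
  obtain ⟨x, y, hd⟩ := hd
  rw [smul_cls, smul_cls, ← map_add, eq_comm, cls_eq_cls_iff] at hd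
  obtain ⟨z, rfl⟩ := hd
  have : θ ^ 2 - θ = (incl Fs x * A + incl Fs y * C + algebraMap F Fs z) ^ 2 -
      (incl Fs x * A + incl Fs y * C + algebraMap F Fs z) := by
    rw [add_sq_sub, add_sq_sub, incl_mul_sq_sub, incl_mul_sq_sub, h.root_left, h.root_right, hθ]
    simp [map_incl]
  obtain ⟨n, rfl⟩ := exists_eq_add_incl this
  simp [algEquiv_incl, hA, hC]

theorem mem_of_fixed {x : Fs} (hx : ∀ s : Gal(Fs/F), s A = A → s C = C → s x = x) :
    x ∈ rootField Fs (V : Set (ASQuot F)) :=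
  mem_of_forall_fixed _ fun s hs => hx s (hs _ h.left_mem) (hs _ h.right_mem)

theorem rootField_eq : rootField Fs (V : Set (ASQuot F)) = IntermediateField.adjoin F {A, C} := by
  apply le_antisymm
  · intro x hx
    refine mem_of_forall_fixed _ fun s hs => h.forall_fixed (hs _ ?_) (hs _ ?_) x hx
    · exact IntermediateField.subset_adjoin _ _ (by simp)
    · exact IntermediateField.subset_adjoin _ _ (by simp)
  · rw [IntermediateField.adjoin_le_iff]
    rintro x (rfl | rfl)
    · exact h.left_mem
    · exact h.right_mem

theorem finiteDimensional : FiniteDimensional F (rootField Fs (V : Set (ASQuot F))) := by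
  rw [h.rootField_eq]
  exact IntermediateField.finiteDimensional_adjoin fun x _ =>
    Algebra.IsIntegral.isIntegral x

theorem map_eq_add (s : Gal(Fs/F)) :
    ∃ i j, s A = A + incl Fs i ∧ s C = C + incl Fs j := by
  obtain ⟨i, hi⟩ := exists_map_eq_add h.root_left s
  obtain ⟨j, hj⟩ := exists_map_eq_add h.root_right s
  exact ⟨i, j, hi, hj⟩

theorem isGalois : IsGalois F (rootField Fs (V : Set (ASQuot F))) := by
  rw [← InfiniteGalois.normal_iff_isGalois]
  constructor
  intro n hn g x
  obtain ⟨i, j, hi, hj⟩ := h.map_eq_add g⁻¹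
  have hn' : ∀ x ∈ rootField Fs (V : Set (ASQuot F)), n x = x := fun x hx => hn ⟨x, hx⟩
  have hg : ∀ x, g (g⁻¹ x) = x := fun x => by rw [← AlgEquiv.mul_apply, mul_inv_cancel]; rfl
  -- Normality of the fixing subgroup: g⁻¹ only translates A and C by constants, so n fixes the
  -- translates.
  refine h.forall_fixed (s := g * n * g⁻¹) ?_ ?_ x x.2
  · simp only [AlgEquiv.mul_apply]
    rw [hi, map_add, hn' A h.left_mem, algEquiv_incl, ← hi, hg]
  · simp only [AlgEquiv.mul_apply]
    rw [hj, map_add, hn' C h.right_mem, algEquiv_incl, ← hj, hg]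

theorem eq_on_of_eq {s t : Gal(Fs/F)} (hA : s A = t A) (hC : s C = t C) {x : Fs}
    (hx : x ∈ rootField Fs (V : Set (ASQuot F))) : s x = t x := by
  have := h.forall_fixed (s := t⁻¹ * s)
    (by rw [AlgEquiv.mul_apply, hA, ← AlgEquiv.mul_apply, inv_mul_cancel]; rfl)
    (by rw [AlgEquiv.mul_apply, hC, ← AlgEquiv.mul_apply, inv_mul_cancel]; rfl) x hx
  conv_rhs => rw [← this, ← AlgEquiv.mul_apply, mul_inv_cancel_left]

theorem restrict_bijective {γ : ZMod 2 × ZMod 2 → Gal(Fs/F)}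
    (hγ : ∀ p, γ p A = A + incl Fs p.1 ∧ γ p C = C + incl Fs p.2) :
    haveI := h.isGalois
    Function.Bijective fun p =>
      AlgEquiv.restrictNormalHom (rootField Fs (V : Set (ASQuot F))) (γ p) := by
  have := h.isGalois
  constructor
  · intro p q hpq
    have key : ∀ x ∈ rootField Fs (V : Set (ASQuot F)), γ p x = γ q x := by
      intro x hx
      have := congrArg (fun g : Gal(rootField Fs (V : Set (ASQuot F))/F) =>
        (g ⟨x, hx⟩ : Fs)) hpq
      simpa only [AlgEquiv.restrictNormalHom_apply] using this
    have h1 := key A h.left_mem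
    have h2 := key C h.right_mem
    rw [(hγ p).1, (hγ q).1, add_right_inj] at h1
    rw [(hγ p).2, (hγ q).2, add_right_inj] at h2
    exact Prod.ext (incl_injective h1) (incl_injective h2)
  · intro g
    obtain ⟨s, rfl⟩ := AlgEquiv.restrictNormalHom_surjective Fs g
    obtain ⟨i, j, hi, hj⟩ := h.map_eq_add s
    refine ⟨(i, j), AlgEquiv.ext fun x => Subtype.ext ?_⟩
    rw [AlgEquiv.restrictNormalHom_apply, AlgEquiv.restrictNormalHom_apply]
    exact h.eq_on_of_eq (by rw [hi, (hγ _).1]) (by rw [hj, (hγ _).2]) x.2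

theorem exists_lift : ∃ γ : ZMod 2 × ZMod 2 → Gal(Fs/F),
    ∀ p, γ p A = A + incl Fs p.1 ∧ γ p C = C + incl Fs p.2 := by
  choose γ hγ using h.exists_map_eq
  exact ⟨fun p => γ p.1 p.2, fun p => hγ p.1 p.2⟩

theorem card_gal : Nat.card Gal(rootField Fs (V : Set (ASQuot F))/F) = 4 := by
  obtain ⟨γ, hγ⟩ := h.exists_lift
  rw [← Nat.card_congr (Equiv.ofBijective _ (h.restrict_bijective hγ)), Nat.card_prod]
  simp

theorem algebraMap_trace {γ : ZMod 2 × ZMod 2 → Gal(Fs/F)}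
    (hγ : ∀ p, γ p A = A + incl Fs p.1 ∧ γ p C = C + incl Fs p.2)
    (δ : rootField Fs (V : Set (ASQuot F))) :
    algebraMap F Fs (Algebra.trace F _ δ) = ∑ p, γ p δ := by
  have := h.isGalois
  have := h.finiteDimensional
  have h1 := congrArg (algebraMap (rootField Fs (V : Set (ASQuot F))) Fs)
    (trace_eq_sum_automorphisms (K := F) δ)
  rw [← IsScalarTower.algebraMap_apply] at h1
  rw [h1, map_sum, ← (Equiv.ofBijective _ (h.restrict_bijective hγ)).sum_comp]
  exact Finset.sum_congr rfl fun p _ => AlgEquiv.restrictNormalHom_apply _ _ _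

/-- The conjugates of δ are δ, δ + d', δ + d and δ + d + d' + b, and their differences recover d, d'
and b. -/
theorem cls_mem_span_iff {δ d d' : rootField Fs (V : Set (ASQuot F))} {b : F}
    (hact : ∀ (s : Gal(Fs/F)) i j, s A = A + incl Fs i → s C = C + incl Fs j →
      s δ = δ + incl Fs j * d' + incl Fs i * (d + incl Fs j * algebraMap F Fs b))
    (e : rootField Fs (V : Set (ASQuot F))) :
    cls e ∈ Submodule.span (MonoidAlgebra (ZMod 2) Gal(rootField Fs (V : Set (ASQuot F))/F))
      {cls δ} ↔ ∃ x y z w : ZMod 2, cls e =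
        cls (incl _ x * δ + incl _ y * d + incl _ z * d' + incl _ w * algebraMap F _ b) := by
  have := h.isGalois
  have hcoe : ∀ n, ((incl (rootField Fs (V : Set (ASQuot F))) n : _) : Fs) = incl Fs n :=
    map_incl (algebraMap (rootField Fs (V : Set (ASQuot F))) Fs)
  have hres : ∀ (s : Gal(Fs/F)) i j, s A = A + incl Fs i → s C = C + incl Fs j →
      AlgEquiv.restrictNormalHom (rootField Fs (V : Set (ASQuot F))) s δ =
        δ + incl _ j * d' + incl _ i * (d + incl _ j * algebraMap F _ b) := by
    intro s i j hi hj
    apply Subtype.ext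
    rw [AlgEquiv.restrictNormalHom_apply, hact s i j hi hj]
    simp [hcoe]
  constructor
  · intro he
    obtain ⟨r, hr⟩ := Submodule.mem_span_singleton.1 he
    rw [← hr]
    clear he hr
    induction r using MonoidAlgebra.induction_linear with
    | zero => exact ⟨0, 0, 0, 0, by simp⟩
    | add r r' hr hr' =>
      obtain ⟨x, y, z, w, hr⟩ := hr
      obtain ⟨x', y', z', w', hr'⟩ := hr'
      refine ⟨x + x', y + y', z + z', w + w', ?_⟩
      rw [add_smul, hr, hr', ← map_add]
      congr 1
      simp only [map_add]
      ring
    | single g n =>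
      rcases unipotentGroup.zmod_two_cases n with rfl | rfl
      · exact ⟨0, 0, 0, 0, by simp⟩
      · obtain ⟨s, rfl⟩ := AlgEquiv.restrictNormalHom_surjective Fs g
        obtain ⟨i, j, hi, hj⟩ := h.map_eq_add s
        refine ⟨1, i, j, i * j, ?_⟩
        rw [single_one_smul_cls, hres s i j hi hj]
        congr 1
        simp only [map_mul, map_one]
        ring
  · rintro ⟨x, y, z, w, he⟩
    rw [he]
    set W := Submodule.span (MonoidAlgebra (ZMod 2) Gal(rootField Fs (V : Set (ASQuot F))/F))
      {cls δ}
    have hδ : cls δ ∈ W := Submodule.subset_span rfl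
    have hg : ∀ g : Gal(rootField Fs (V : Set (ASQuot F))/F), cls (g δ) ∈ W := fun g => by
      rw [← single_one_smul_cls]
      exact W.smul_mem _ hδ
    have hij : ∀ i j,
        cls (δ + incl _ j * d' + incl _ i * (d + incl _ j * algebraMap F _ b)) ∈ W := by
      intro i j
      obtain ⟨s, hi, hj⟩ := h.exists_map_eq i j
      rw [← hres s i j hi hj]
      exact hg _
    have h1 : cls d ∈ W := by
      have := W.sub_mem (hij 1 0) hδ
      rw [← map_sub] at this
      simpa using this
    have h2 : cls d' ∈ W := by
      have := W.sub_mem (hij 0 1) hδ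
      rw [← map_sub] at this
      simpa using this
    have h3 : cls (algebraMap F _ b) ∈ W := by
      have := W.sub_mem (W.sub_mem (W.sub_mem (hij 1 1) hδ) h1) h2
      rw [← map_sub, ← map_sub, ← map_sub] at this
      convert this using 2
      simp
      ring
    have hm : ∀ (n : ZMod 2) u, cls u ∈ W →
        cls (incl (rootField Fs (V : Set (ASQuot F))) n * u) ∈ W := by
      intro n u hu
      rcases unipotentGroup.zmod_two_cases n with rfl | rfl <;> simp [hu]
    simp only [map_add]
    exact W.add_mem (W.add_mem (W.add_mem (hm _ _ hδ) (hm _ _ h1)) (hm _ _ h2)) (hm _ _ h3)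

end IsRootPair

/-! ### Frames and the module generated by `[δ]` -/

open unipotentGroup

theorem sum_zmod_two {M : Type*} [AddCommMonoid M] (f : ZMod 2 × ZMod 2 → M) :
    ∑ p, f p = f (0, 0) + f (0, 1) + (f (1, 0) + f (1, 1)) := by
  have h : ∀ g : ZMod 2 → M, ∑ n, g n = g 0 + g 1 := Fin.sum_univ_two
  rw [Fintype.sum_prod_type, h, h, h]

/-- The four conjugates add up to 4δ + 2d + 2d' + b. -/
theorem IsRootPair.trace_eq {V : Submodule (ZMod 2) (ASQuot F)} {a c : F} {A C : Fs}
    (h : IsRootPair V a c A C) {δ : rootField Fs (V : Set (ASQuot F))} {d d' : Fs} {b : F}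
    (hact : ∀ (s : Gal(Fs/F)) i j, s A = A + incl Fs i → s C = C + incl Fs j →
      s δ = δ + incl Fs j * d' + incl Fs i * (d + incl Fs j * algebraMap F Fs b)) :
    Algebra.trace F _ δ = b := by
  obtain ⟨γ, hγ⟩ := h.exists_lift
  apply (algebraMap F Fs).injective
  have h2 : (2 : Fs) = 0 := CharTwo.two_eq_zero
  simp only [h.algebraMap_trace hγ, sum_zmod_two, hact _ _ _ (hγ _).1 (hγ _).2, map_one, map_zero]
  linear_combination (2 * (δ : Fs) + d + d') * h2

/-- The six elements are the entries of a unipotent matrix `X` over `Fs` with `s X = X r(s)`, up to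
the substitution that makes the four entries of the upper right block roots of Artin-Schreier
polynomials. -/
structure IsFrame (r : Gal(Fs/F) →* unipotentGroup 4 (ZMod 2)) (A B C P Q Y : Fs) : Prop where
  map_A : ∀ s, s A = A + incl Fs (entry (r s) 0 1)
  map_B : ∀ s, s B = B + incl Fs (entry (r s) 1 2)
  map_C : ∀ s, s C = C + incl Fs (entry (r s) 2 3)
  map_P : ∀ s, s P = P + incl Fs (entry (r s) 0 2) +
    incl Fs (entry (r s) 0 1) * (B + incl Fs (entry (r s) 1 2))
  map_Q : ∀ s, s Q = Q + incl Fs (entry (r s) 2 3) * B + incl Fs (entry (r s) 1 3)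
  map_Y : ∀ s, s Y = Y + incl Fs (entry (r s) 2 3) * P + incl Fs (entry (r s) 0 3) +
    incl Fs (entry (r s) 0 1) * (Q + incl Fs (entry (r s) 2 3) * B + incl Fs (entry (r s) 1 3))

namespace IsFrame

variable {r : Gal(Fs/F) →* unipotentGroup 4 (ZMod 2)} {A B C P Q Y : Fs}
  (f : IsFrame r A B C P Q Y)
include f

theorem entry_zero_one_eq_zero_iff (s : Gal(Fs/F)) : entry (r s) 0 1 = 0 ↔ s A = A := by
  rw [f.map_A, add_eq_left, map_eq_zero]

theorem entry_two_three_eq_zero_iff (s : Gal(Fs/F)) : entry (r s) 2 3 = 0 ↔ s C = C := by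
  rw [f.map_C, add_eq_left, map_eq_zero]

/-- Over E the action on B, P, Q, Y is by translations, each with its own matrix entry; this makes
Artin-Schreier theory over E applicable. -/
theorem map_of_fixed {s : Gal(Fs/F)} (hA : s A = A) (hC : s C = C) :
    s B = B + incl Fs (entry (r s) 1 2) ∧ s P = P + incl Fs (entry (r s) 0 2) ∧
      s Q = Q + incl Fs (entry (r s) 1 3) ∧ s Y = Y + incl Fs (entry (r s) 0 3) := by
  rw [← f.entry_zero_one_eq_zero_iff] at hA
  rw [← f.entry_two_three_eq_zero_iff] at hC
  refine ⟨f.map_B s, ?_, ?_, ?_⟩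
  · simp [f.map_P, hA]
  · simp [f.map_Q, hC]
  · simp [f.map_Y, hA, hC]

theorem map_eq_one_iff (s : Gal(Fs/F)) :
    r s = 1 ↔ s A = A ∧ s B = B ∧ s C = C ∧ s P = P ∧ s Q = Q ∧ s Y = Y := by
  constructor
  · intro h
    simp [f.map_A, f.map_B, f.map_C, f.map_P, f.map_Q, f.map_Y, h]
  · rintro ⟨hA, hB, hC, hP, hQ, hY⟩
    obtain ⟨h1, h2, h3, h4⟩ := f.map_of_fixed hA hC
    rw [hB, left_eq_add, map_eq_zero] at h1
    rw [hP, left_eq_add, map_eq_zero] at h2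
    rw [hQ, left_eq_add, map_eq_zero] at h3
    rw [hY, left_eq_add, map_eq_zero] at h4
    rw [← f.entry_zero_one_eq_zero_iff] at hA
    rw [← f.entry_two_three_eq_zero_iff] at hC
    apply ext_four <;> simp [*]

/-- As ℘ is 𝔽₂-linear and kills 𝔽₂, only the entries r₀₁ and r₂₃, which describe the action on A and
C, survive. -/
theorem map_sq_sub (s : Gal(Fs/F)) :
    s (Y ^ 2 - Y) = Y ^ 2 - Y + incl Fs (entry (r s) 2 3) * (P ^ 2 - P) +
      incl Fs (entry (r s) 0 1) * (Q ^ 2 - Q + incl Fs (entry (r s) 2 3) * (B ^ 2 - B)) := by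
  rw [map_sub, map_pow, f.map_Y]
  simp only [add_sq_sub, incl_mul_sq_sub, incl_sq_sub, add_zero]

variable {V : Submodule (ZMod 2) (ASQuot F)} {a b c : F} (h : IsRootPair V a c A C)
  (hB : B ^ 2 - B = algebraMap F Fs b)
include h

theorem exists_roots :
    ∃ d d' : rootField Fs (V : Set (ASQuot F)), (d : Fs) = Q ^ 2 - Q ∧ (d' : Fs) = P ^ 2 - P := by
  refine ⟨⟨Q ^ 2 - Q, h.mem_of_fixed fun s hA hC => ?_⟩,
    ⟨P ^ 2 - P, h.mem_of_fixed fun s hA hC => ?_⟩, rfl, rfl⟩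
  · rw [map_sub, map_pow, (f.map_of_fixed hA hC).2.2.1, add_sq_sub, incl_sq_sub, add_zero]
  · rw [map_sub, map_pow, (f.map_of_fixed hA hC).2.1, add_sq_sub, incl_sq_sub, add_zero]

theorem sq_sub_mem : Y ^ 2 - Y ∈ rootField Fs (V : Set (ASQuot F)) :=
  h.mem_of_fixed fun s hA hC => by
    rw [map_sub, map_pow, (f.map_of_fixed hA hC).2.2.2, add_sq_sub, incl_sq_sub, add_zero]

variable {δ d d' : rootField Fs (V : Set (ASQuot F))} (hδ : (δ : Fs) = Y ^ 2 - Y)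
  (hd : (d : Fs) = Q ^ 2 - Q) (hd' : (d' : Fs) = P ^ 2 - P)
include hB hδ

theorem map_generator (s : Gal(Fs/F)) (i j : ZMod 2) (hi : s A = A + incl Fs i)
    (hj : s C = C + incl Fs j) :
    s δ = δ + incl Fs j * (P ^ 2 - P) +
      incl Fs i * (Q ^ 2 - Q + incl Fs j * algebraMap F Fs b) := by
  rw [f.map_A, add_right_inj] at hi
  rw [f.map_C, add_right_inj] at hj
  rw [hδ, f.map_sq_sub, hB, hi, hj]

theorem trace_eq : Algebra.trace F _ δ = b :=
  h.trace_eq (f.map_generator h hB hδ)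

include hd hd'

theorem cls_mem_span_iff (e : rootField Fs (V : Set (ASQuot F))) :
    cls e ∈ Submodule.span (MonoidAlgebra (ZMod 2) Gal(rootField Fs (V : Set (ASQuot F))/F))
      {cls δ} ↔ ∃ x y z w : ZMod 2, cls e =
        cls (incl _ x * δ + incl _ y * d + incl _ z * d' + incl _ w * algebraMap F _ b) :=
  h.cls_mem_span_iff (fun s i j hi hj => by rw [f.map_generator h hB hδ s i j hi hj, hd, hd']) e

omit h hB f in
-- This exhibits a root for every representative of a class in the module; u accounts for the change
-- of representative modulo ℘(E).
theorem sq_sub_combination (hB : B ^ 2 - B = algebraMap F Fs b) (x y z w : ZMod 2) (u : Fs) :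
    (incl Fs x * Y + incl Fs y * Q + incl Fs z * P + incl Fs w * B + u) ^ 2 -
      (incl Fs x * Y + incl Fs y * Q + incl Fs z * P + incl Fs w * B + u) =
    ((incl _ x * δ + incl _ y * d + incl _ z * d' + incl _ w * algebraMap F _ b :
      rootField Fs (V : Set (ASQuot F))) : Fs) + (u ^ 2 - u) := by
  have hcoe : ∀ n, ((incl (rootField Fs (V : Set (ASQuot F))) n : _) : Fs) = incl Fs n :=
    map_incl (algebraMap (rootField Fs (V : Set (ASQuot F))) Fs)
  simp only [add_sq_sub, incl_mul_sq_sub]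
  simp [hcoe, hδ, hd, hd', hB]

/-- A class has roots in the field cut out by `r` exactly if it lies in the module generated
by `[δ]`. -/
theorem cls_mem_span_iff_exists (hr : Function.Surjective r) {L : IntermediateField F Fs}
    (hL : ∀ s, r s = 1 ↔ ∀ x ∈ L, s x = x) (e : rootField Fs (V : Set (ASQuot F))) :
    cls e ∈ Submodule.span (MonoidAlgebra (ZMod 2) Gal(rootField Fs (V : Set (ASQuot F))/F))
      {cls δ} ↔ ∃ θ ∈ L, θ ^ 2 - θ = (e : Fs) := by
  rw [f.cls_mem_span_iff h hB hδ hd hd']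
  constructor
  · rintro ⟨x, y, z, w, he⟩
    obtain ⟨u, rfl⟩ := (cls_eq_cls_iff _ _).1 he
    refine ⟨incl Fs x * Y + incl Fs y * Q + incl Fs z * P + incl Fs w * B + u, ?_, ?_⟩
    · refine mem_of_forall_fixed _ fun s hs => ?_
      obtain ⟨hA, hB, hC, hP, hQ, hY⟩ := (f.map_eq_one_iff s).1 ((hL s).2 hs)
      simp only [map_add, map_mul, algEquiv_incl, hB, hP, hQ, hY, h.forall_fixed hA hC u u.2]
    · rw [sq_sub_combination hδ hd hd' hB]
      rfl
  · rintro ⟨θ, hθL, hθ⟩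
    have shift : ∀ s : Gal(Fs/F), s A = A → s C = C → ∃ n, s θ = θ + incl Fs n := by
      intro s hA hC
      refine exists_eq_add_incl ?_
      rw [← map_pow, ← map_sub, hθ, h.forall_fixed hA hC e e.2]
    have fixA : ∀ {s : Gal(Fs/F)}, entry (r s) 0 1 = 0 → s A = A := fun {s} =>
      (f.entry_zero_one_eq_zero_iff s).1
    have fixC : ∀ {s : Gal(Fs/F)}, entry (r s) 2 3 = 0 → s C = C := fun {s} =>
      (f.entry_two_three_eq_zero_iff s).1
    obtain ⟨sB, hsB⟩ := hr (ofEntries 0 1 0 0 0 0)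
    obtain ⟨sP, hsP⟩ := hr (ofEntries 0 0 0 1 0 0)
    obtain ⟨sQ, hsQ⟩ := hr (ofEntries 0 0 0 0 1 0)
    obtain ⟨sY, hsY⟩ := hr (ofEntries 0 0 0 0 0 1)
    -- The coefficients are read off from how θ moves under four automorphisms over E, each
    -- translating exactly one of B, P, Q, Y. Subtracting the matching combination leaves u, which
    -- these four and ker r all fix; they generate the preimage of the subgroup M₀₁ = M₂₃ = 0, so u
    -- lies in E.
    obtain ⟨w, hw⟩ := shift sB (fixA (by simp [hsB])) (fixC (by simp [hsB]))
    obtain ⟨z, hz⟩ := shift sP (fixA (by simp [hsP])) (fixC (by simp [hsP]))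
    obtain ⟨y, hy⟩ := shift sQ (fixA (by simp [hsQ])) (fixC (by simp [hsQ]))
    obtain ⟨x, hx⟩ := shift sY (fixA (by simp [hsY])) (fixC (by simp [hsY]))
    set u := θ - (incl Fs x * Y + incl Fs y * Q + incl Fs z * P + incl Fs w * B) with hu
    let S := MulAction.stabilizer Gal(Fs/F) u
    have mem_S : ∀ s, s ∈ S ↔ s u = u := fun s => Iff.rfl
    have hker : ∀ s, r s = 1 → s ∈ S := by
      intro s hs
      obtain ⟨hA, hB, hC, hP, hQ, hY⟩ := (f.map_eq_one_iff s).1 hs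
      rw [mem_S, hu]
      simp only [map_add, map_sub, map_mul, algEquiv_incl, hB, hP, hQ, hY, (hL s).1 hs θ hθL]
    have hcongr : ∀ {s t}, t ∈ S → r s = r t → s ∈ S := by
      intro s t ht hst
      have := S.mul_mem (hker (s * t⁻¹) (by rw [map_mul, map_inv, hst, mul_inv_cancel])) ht
      simpa using this
    have hpow : ∀ {s} {g : ZMod 2 → unipotentGroup 4 (ZMod 2)}, s ∈ S → r s = g 1 → g 0 = 1 →
        ∀ n, ∃ t ∈ S, r t = g n := by
      intro s g hs h1 h0 n
      rcases zmod_two_cases n with rfl | rfl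
      · exact ⟨1, S.one_mem, by rw [h0, map_one]⟩
      · exact ⟨s, hs, h1⟩
    have one_eq : ofEntries 0 0 0 0 0 0 = (1 : unipotentGroup 4 (ZMod 2)) := by
      apply ext_four <;> simp
    have map_u : ∀ (s : Gal(Fs/F)) x' y' z' w', r s = ofEntries 0 w' 0 z' y' x' →
        s u = u + (s θ - θ - (incl Fs x * incl Fs x' + incl Fs y * incl Fs y' +
          incl Fs z * incl Fs z' + incl Fs w * incl Fs w')) := by
      intro s x' y' z' w' hs
      obtain ⟨h1, h2, h3, h4⟩ := f.map_of_fixed (s := s) (fixA (by simp [hs])) (fixC (by simp [hs]))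
      rw [hu]
      simp only [map_add, map_sub, map_mul, algEquiv_incl, h1, h2, h3, h4, hs,
        ofEntries_entry_one_two, ofEntries_entry_zero_two, ofEntries_entry_one_three,
        ofEntries_entry_zero_three]
      ring
    have pB := hpow (g := fun n => ofEntries 0 n 0 0 0 0) (s := sB)
      (by rw [mem_S, map_u sB _ _ _ _ hsB, hw]; simp) hsB one_eq
    have pP := hpow (g := fun n => ofEntries 0 0 0 n 0 0) (s := sP)
      (by rw [mem_S, map_u sP _ _ _ _ hsP, hz]; simp) hsP one_eq
    have pQ := hpow (g := fun n => ofEntries 0 0 0 0 n 0) (s := sQ)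
      (by rw [mem_S, map_u sQ _ _ _ _ hsQ, hy]; simp) hsQ one_eq
    have pY := hpow (g := fun n => ofEntries 0 0 0 0 0 n) (s := sY)
      (by rw [mem_S, map_u sY _ _ _ _ hsY, hx]; simp) hsY one_eq
    have huE : u ∈ rootField Fs (V : Set (ASQuot F)) := by
      refine h.mem_of_fixed fun s hA hC => ?_
      rw [← f.entry_zero_one_eq_zero_iff] at hA
      rw [← f.entry_two_three_eq_zero_iff] at hC
      obtain ⟨tB, htB, hB'⟩ := pB (entry (r s) 1 2)
      obtain ⟨tP, htP, hP'⟩ := pP (entry (r s) 0 2)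
      obtain ⟨tQ, htQ, hQ'⟩ := pQ (entry (r s) 1 3)
      obtain ⟨tY, htY, hY'⟩ := pY (entry (r s) 0 3)
      refine (mem_S s).1 (hcongr (S.mul_mem (S.mul_mem htB htP) (S.mul_mem htQ htY)) ?_)
      rw [map_mul, map_mul, map_mul, hB', hP', hQ', hY']
      apply ext_four <;> simp [hA, hC]
    refine ⟨x, y, z, w, (cls_eq_cls_iff _ _).2 ⟨⟨u, huE⟩, Subtype.ext ?_⟩⟩
    rw [← hθ, ← sub_add_cancel θ (incl Fs x * Y + incl Fs y * Q + incl Fs z * P + incl Fs w * B),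
      ← hu, add_comm, sq_sub_combination hδ hd hd' hB]
    rfl

/-- Equal classes give equal combinations of Y, Q, P, B modulo E; automorphisms over E with
prescribed translations then compare the coefficients one at a time. -/
theorem combination_injective (hr : Function.Surjective r) {x y z w x' y' z' w' : ZMod 2}
    (heq : (cls (incl _ x * δ + incl _ y * d + incl _ z * d' + incl _ w * algebraMap F _ b) :
        ASQuot (rootField Fs (V : Set (ASQuot F)))) =
      cls (incl _ x' * δ + incl _ y' * d + incl _ z' * d' + incl _ w' * algebraMap F _ b)) :
    x = x' ∧ y = y' ∧ z = z' ∧ w = w' := by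
  obtain ⟨u, hu⟩ := (cls_eq_cls_iff _ _).1 heq
  have h1 := congrArg (algebraMap (rootField Fs (V : Set (ASQuot F))) Fs) hu
  have h2 := sq_sub_combination hδ hd hd' hB x y z w 0
  have h3 := sq_sub_combination hδ hd hd' hB x' y' z' w' u
  rw [map_add] at h1
  obtain ⟨m, hm⟩ := exists_eq_add_incl (h2.trans ((by simpa using h1 : _ = _).trans h3.symm))
  have key : ∀ w₀ z₀ y₀ x₀ : ZMod 2, x * x₀ + y * y₀ + z * z₀ + w * w₀ =
      x' * x₀ + y' * y₀ + z' * z₀ + w' * w₀ := by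
    intro w₀ z₀ y₀ x₀
    obtain ⟨s, hs⟩ := hr (ofEntries 0 w₀ 0 z₀ y₀ x₀)
    have hA := (f.entry_zero_one_eq_zero_iff s).1 (by simp [hs])
    have hC := (f.entry_two_three_eq_zero_iff s).1 (by simp [hs])
    obtain ⟨h1, h2, h3, h4⟩ := f.map_of_fixed (s := s) hA hC
    have h5 := congrArg s hm
    simp only [map_add, map_mul, algEquiv_incl, h1, h2, h3, h4, hs, h.forall_fixed hA hC u u.2,
      ofEntries_entry_one_two, ofEntries_entry_zero_two, ofEntries_entry_one_three,
        ofEntries_entry_zero_three, map_zero] at h5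
    apply incl_injective (K := Fs)
    simp only [map_add, map_mul]
    linear_combination h5 - hm
  refine ⟨?_, ?_, ?_, ?_⟩
  · simpa using key 0 0 0 1
  · simpa using key 0 0 1 0
  · simpa using key 0 1 0 0
  · simpa using key 1 0 0 0

/-- The group ring has 2⁴ = 16 elements and maps onto the cyclic module, which has at least 16 by
`combination_injective`; so the map is bijective. -/
theorem free_span (hr : Function.Surjective r) :
    Module.Free (MonoidAlgebra (ZMod 2) Gal(rootField Fs (V : Set (ASQuot F))/F))
      (Submodule.span (MonoidAlgebra (ZMod 2) Gal(rootField Fs (V : Set (ASQuot F))/F))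
        {(cls δ : ASQuot (rootField Fs (V : Set (ASQuot F))))}) := by
  set R := MonoidAlgebra (ZMod 2) Gal(rootField Fs (V : Set (ASQuot F))/F)
  set W := Submodule.span R {(cls δ : ASQuot (rootField Fs (V : Set (ASQuot F))))}
  have := h.finiteDimensional
  have hcardR : Nat.card R = 16 := by
    rw [Nat.card_congr (MonoidAlgebra.coeffEquiv.trans Finsupp.equivFunOnFinite), Nat.card_fun,
      h.card_gal]
    simp
  have : Finite R := Nat.finite_of_card_ne_zero (by rw [hcardR]; simp)
  let φ : R →ₗ[R] W := LinearMap.toSpanSingleton R W ⟨cls δ, Submodule.subset_span rfl⟩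
  have hφ : Function.Surjective φ := by
    rintro ⟨v, hv⟩
    obtain ⟨x, rfl⟩ := Submodule.mem_span_singleton.1 hv
    exact ⟨x, rfl⟩
  have : Finite W := Finite.of_surjective φ hφ
  have hcardW : 16 ≤ Nat.card W := by
    let ψ : ZMod 2 × ZMod 2 × ZMod 2 × ZMod 2 → W := fun p =>
      ⟨cls (incl _ p.1 * δ + incl _ p.2.1 * d + incl _ p.2.2.1 * d' +
        incl _ p.2.2.2 * algebraMap F _ b),
        (f.cls_mem_span_iff h hB hδ hd hd' _).2 ⟨_, _, _, _, rfl⟩⟩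
    have hψ : Function.Injective ψ := by
      intro p q hpq
      obtain ⟨h1, h2, h3, h4⟩ :=
        f.combination_injective h hB hδ hd hd' hr (congrArg Subtype.val hpq)
      exact Prod.ext h1 (Prod.ext h2 (Prod.ext h3 h4))
    have := Nat.card_le_card_of_injective ψ hψ
    simpa [Nat.card_prod] using this
  have hbij : Function.Bijective φ :=
    hφ.bijective_of_nat_card_le (by rw [hcardR]; exact hcardW)
  exact Module.Free.of_equiv (LinearEquiv.ofBijective φ hbij)

end IsFrame

theorem Triple.E_le_L (t : Triple F Fs) : t.E ≤ t.L := fun x hx =>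
  (rootField Fs (t.W : Set (ASQuot t.E))).algebraMap_mem ⟨x, hx⟩

namespace IsFrame

variable {r : Gal(Fs/F) →* unipotentGroup 4 (ZMod 2)} {A B C P Q Y : Fs}
  (f : IsFrame r A B C P Q Y) {a b c : F}
include f

/-- The field generated by the roots of the classes in the module generated by `[δ]` is the field
cut out by `r`. -/
theorem map_eq_one_iff_forall {t : Triple F Fs} (h : IsRootPair t.V a c A C)
    (hB : B ^ 2 - B = algebraMap F Fs b) {δ : t.E} (hδ : (δ : Fs) = Y ^ 2 - Y)
    (hW : t.W = Submodule.span (MonoidAlgebra (ZMod 2) Gal(t.E/F)) {cls δ}) (s : Gal(Fs/F)) :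
    r s = 1 ↔ ∀ x ∈ t.L, s x = x := by
  obtain ⟨d, d', hd, hd'⟩ := f.exists_roots h
  have hmem := f.cls_mem_span_iff h hB hδ hd hd'
  rw [← hW] at hmem
  constructor
  · intro hs
    obtain ⟨hA, hB', hC, hP, hQ, hY⟩ := (f.map_eq_one_iff s).1 hs
    have hE := h.forall_fixed hA hC
    -- The field L is generated over E, so s must be viewed as an automorphism over E.
    let s' : Gal(Fs/t.E) := t.E.fixingSubgroupEquiv ⟨s, fun x => hE x x.2⟩
    refine forall_mem_rootField (s := s') fun θ e he hθ => ?_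
    obtain ⟨x, y, z, w, he⟩ := (hmem e).1 he
    obtain ⟨u, rfl⟩ := (cls_eq_cls_iff _ _).1 he
    have h1 := sq_sub_combination hδ hd hd' hB x y z w u
    obtain ⟨n, rfl⟩ := exists_eq_add_incl (hθ.trans h1.symm)
    change s _ = _
    simp only [map_add, map_mul, algEquiv_incl, hB', hP, hQ, hY, hE u u.2]
  · intro hs
    refine (f.map_eq_one_iff s).2 ⟨hs _ (t.E_le_L h.left_mem), hs _ ?_, hs _ (t.E_le_L h.right_mem),
      hs _ ?_, hs _ ?_, hs _ ?_⟩
    · exact mem_rootField (a := algebraMap F t.E b) ((hmem _).2 ⟨0, 0, 0, 1, by simp⟩)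
        (by rw [hB]; rfl)
    · exact mem_rootField (a := d') ((hmem _).2 ⟨0, 0, 1, 0, by simp⟩) hd'.symm
    · exact mem_rootField (a := d) ((hmem _).2 ⟨0, 1, 0, 0, by simp⟩) hd.symm
    · exact mem_rootField (a := δ) ((hmem _).2 ⟨1, 0, 0, 0, by simp⟩) hδ.symm

variable {L : IntermediateField F Fs} (hL : ∀ s, r s = 1 ↔ ∀ x ∈ L, s x = x)
include hL

theorem all_mem : A ∈ L ∧ B ∈ L ∧ C ∈ L ∧ P ∈ L ∧ Q ∈ L ∧ Y ∈ L := by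
  have h := fun s => (f.map_eq_one_iff s).1
  simp only [hL] at h
  exact ⟨mem_of_forall_fixed _ fun s hs => (h s hs).1,
    mem_of_forall_fixed _ fun s hs => (h s hs).2.1,
    mem_of_forall_fixed _ fun s hs => (h s hs).2.2.1,
    mem_of_forall_fixed _ fun s hs => (h s hs).2.2.2.1,
    mem_of_forall_fixed _ fun s hs => (h s hs).2.2.2.2.1,
    mem_of_forall_fixed _ fun s hs => (h s hs).2.2.2.2.2⟩

theorem finiteDimensional : FiniteDimensional F L := by
  have hle : L ≤ IntermediateField.adjoin F {A, B, C, P, Q, Y} := by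
    intro x hx
    refine mem_of_forall_fixed _ fun s hs => (hL s).1 ((f.map_eq_one_iff s).2 ?_) x hx
    refine ⟨hs _ ?_, hs _ ?_, hs _ ?_, hs _ ?_, hs _ ?_, hs _ ?_⟩ <;>
      exact IntermediateField.subset_adjoin _ _ (by simp)
  have : FiniteDimensional F (IntermediateField.adjoin F {A, B, C, P, Q, Y}) :=
    IntermediateField.finiteDimensional_adjoin fun x _ => Algebra.IsIntegral.isIntegral x
  exact Module.Finite.of_injective (IntermediateField.inclusion hle).toLinearMap
    (IntermediateField.inclusion_injective hle)

omit f in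
theorem fixingSubgroup_eq : L.fixingSubgroup = r.ker := by
  ext s
  rw [MonoidHom.mem_ker, hL]
  exact ⟨fun h x hx => h ⟨x, hx⟩, fun h x => h x x.2⟩

omit f in
theorem isGalois : IsGalois F L := by
  rw [← InfiniteGalois.normal_iff_isGalois, fixingSubgroup_eq hL]
  infer_instance

omit f in
-- Restriction to L and r are surjections with the same kernel.
theorem exists_mulEquiv [IsGalois F L] (hr : Function.Surjective r) :
    ∃ ρ : Gal(L/F) ≃* unipotentGroup 4 (ZMod 2),
      ∀ s, ρ (AlgEquiv.restrictNormalHom L s) = r s := by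
  let e₁ := QuotientGroup.liftEquiv r.ker (AlgEquiv.restrictNormalHom_surjective (F := F)
    (K₁ := L) Fs) (by rw [IntermediateField.restrictNormalHom_ker, fixingSubgroup_eq hL])
  let e₂ := QuotientGroup.liftEquiv r.ker hr rfl
  refine ⟨e₁.symm.trans e₂, fun s => ?_⟩
  have : e₁.symm (AlgEquiv.restrictNormalHom L s) = (s : Gal(Fs/F) ⧸ r.ker) := by
    rw [MulEquiv.symm_apply_eq]
    rfl
  rw [MulEquiv.trans_apply, this]
  rfl

theorem isDual (hA : A ^ 2 - A = algebraMap F Fs a) (hB : B ^ 2 - B = algebraMap F Fs b)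
    (hC : C ^ 2 - C = algebraMap F Fs c) [IsGalois F L]
    {ρ : Gal(L/F) ≃* unipotentGroup 4 (ZMod 2)}
    (hρ : ∀ s, ρ (AlgEquiv.restrictNormalHom L s) = r s) :
    IsDual L (ρ.symm (unipotentGroup.elem (ZMod 2) 0 1 (by decide)))
      (ρ.symm (unipotentGroup.elem (ZMod 2) 1 2 (by decide)))
      (ρ.symm (unipotentGroup.elem (ZMod 2) 2 3 (by decide))) a b c := by
  obtain ⟨memA, memB, memC, -, -, -⟩ := f.all_mem hL
  have hcoe : ∀ (M : unipotentGroup 4 (ZMod 2)) (x : L), ∃ s, r s = M ∧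
      ∀ x : L, ((ρ.symm M x : L) : Fs) = s x := by
    intro M x
    obtain ⟨s, hs⟩ := AlgEquiv.restrictNormalHom_surjective Fs (ρ.symm M)
    refine ⟨s, ?_, fun x => ?_⟩
    · rw [← hρ, hs, MulEquiv.apply_symm_apply]
    · rw [← hs, AlgEquiv.restrictNormalHom_apply]
  have key : ∀ M : unipotentGroup 4 (ZMod 2),
      ((ρ.symm M ⟨A, memA⟩ : L) : Fs) = A + incl Fs (entry M 0 1) ∧
      ((ρ.symm M ⟨B, memB⟩ : L) : Fs) = B + incl Fs (entry M 1 2) ∧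
      ((ρ.symm M ⟨C, memC⟩ : L) : Fs) = C + incl Fs (entry M 2 3) := by
    intro M
    obtain ⟨s, rfl, hs⟩ := hcoe M 0
    exact ⟨by rw [hs, f.map_A], by rw [hs, f.map_B], by rw [hs, f.map_C]⟩
  refine ⟨⟨A, memA⟩, ⟨B, memB⟩, ⟨C, memC⟩,
    ⟨Subtype.ext hA, Subtype.ext hB, Subtype.ext hC⟩, ?_, ?_, ?_⟩
  · rw [elem_zero_one]
    refine ⟨Subtype.ext ?_, Subtype.ext ?_, Subtype.ext ?_⟩
    · rw [(key _).1]; simp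
    · rw [(key _).2.1]; simp
    · rw [(key _).2.2]; simp
  · rw [elem_one_two]
    refine ⟨Subtype.ext ?_, Subtype.ext ?_, Subtype.ext ?_⟩
    · rw [(key _).1]; simp
    · rw [(key _).2.1]; simp
    · rw [(key _).2.2]; simp
  · rw [elem_two_three]
    refine ⟨Subtype.ext ?_, Subtype.ext ?_, Subtype.ext ?_⟩
    · rw [(key _).1]; simp
    · rw [(key _).2.1]; simp
    · rw [(key _).2.2]; simp

theorem isAssociated {t : Triple F Fs} (h : IsRootPair t.V a c A C)
    (hB : B ^ 2 - B = algebraMap F Fs b) {δ : t.E} (hδ : (δ : Fs) = Y ^ 2 - Y)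
    (hW : t.W = Submodule.span (MonoidAlgebra (ZMod 2) Gal(t.E/F)) {cls δ}) (hβ : t.β = cls b)
    (hr : Function.Surjective r) [IsGalois F L]
    {ρ : Gal(L/F) ≃* unipotentGroup 4 (ZMod 2)}
    (hρ : ∀ s, ρ (AlgEquiv.restrictNormalHom L s) = r s) : IsAssociated L ρ t := by
  obtain ⟨d, d', hd, hd'⟩ := f.exists_roots h
  refine ⟨a, b, c, f.isDual hL h.root_left hB h.root_right hρ, hβ, h.span_eq, fun e => ?_⟩
  rw [hW]
  exact f.cls_mem_span_iff_exists h hB hδ hd hd' hr hL e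

end IsFrame

/-! ### From extensions to triples -/

/-- The Galois group of a `U_4(𝔽₂)`-extension admits a frame. -/
theorem exists_isFrame {L : IntermediateField F Fs} [FiniteDimensional F L] [IsGalois F L]
    (ρ : Gal(L/F) →* unipotentGroup 4 (ZMod 2)) :
    ∃ A B C P Q Y : Fs, IsFrame (ρ.comp (AlgEquiv.restrictNormalHom L)) A B C P Q Y := by
  -- Averaging as in Hilbert 90: reindexing the sum gives g X = X ρ(g), and Tr x = 1 makes the
  -- diagonal entries equal to 1.
  obtain ⟨x, hx⟩ := Algebra.trace_surjective F L 1
  let X : Fin 4 → Fin 4 → L := fun i j => ∑ g : Gal(L/F), g x * incl L (entry (ρ g⁻¹) i j)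
  have hX : ∀ (g : Gal(L/F)) i j, g (X i j) = ∑ k, X i k * incl L (entry (ρ g) k j) := by
    intro g i j
    have h1 : g (X i j) = ∑ g', g' x * incl L (entry (ρ (g'⁻¹ * g)) i j) := by
      rw [map_sum]
      refine Fintype.sum_equiv (Equiv.mulLeft g) _ _ fun g' => ?_
      simp [algEquiv_incl, AlgEquiv.mul_apply]
    rw [h1]
    simp only [X, Finset.sum_mul]
    rw [Finset.sum_comm]
    refine Finset.sum_congr rfl fun g' _ => ?_
    rw [map_mul, entry_mul, map_sum, Finset.mul_sum]
    exact Finset.sum_congr rfl fun k _ => by rw [map_mul]; ring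
  have hdiag : ∀ i, X i i = 1 := by
    intro i
    have := trace_eq_sum_automorphisms (K := F) x
    rw [hx, map_one] at this
    simp only [X, entry_diag, map_one, mul_one]
    exact this.symm
  have hlow : ∀ i j, j < i → X i j = 0 := by
    intro i j hij
    refine Finset.sum_eq_zero fun g _ => ?_
    rw [entry_of_lt _ hij, map_zero, mul_zero]
  have hXs : ∀ (s : Gal(Fs/F)) i j, s (X i j) =
      ∑ k, (X i k : Fs) * incl Fs (entry (ρ (AlgEquiv.restrictNormalHom L s)) k j) := by
    intro s i j
    rw [← AlgEquiv.restrictNormalHom_apply, hX]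
    simp only [AddSubmonoidClass.coe_finsetSum, MulMemClass.coe_mul]
    refine Finset.sum_congr rfl fun k _ => ?_
    exact congrArg _ (map_incl (algebraMap L Fs) _)
  have h2 : (2 : Fs) = 0 := CharTwo.two_eq_zero
  have l21 := fun M : unipotentGroup 4 (ZMod 2) => entry_of_lt M (show (1 : Fin 4) < 2 by decide)
  have l31 := fun M : unipotentGroup 4 (ZMod 2) => entry_of_lt M (show (1 : Fin 4) < 3 by decide)
  have l32 := fun M : unipotentGroup 4 (ZMod 2) => entry_of_lt M (show (2 : Fin 4) < 3 by decide)
  have m10 := hlow 1 0 (by decide)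
  have m20 := hlow 2 0 (by decide)
  have m21 := hlow 2 1 (by decide)
  have expand : ∀ (s : Gal(Fs/F)),
      s (X 0 1) = X 0 1 + incl Fs (entry (ρ (AlgEquiv.restrictNormalHom L s)) 0 1) ∧
      s (X 1 2) = X 1 2 + incl Fs (entry (ρ (AlgEquiv.restrictNormalHom L s)) 1 2) ∧
      s (X 2 3) = X 2 3 + incl Fs (entry (ρ (AlgEquiv.restrictNormalHom L s)) 2 3) ∧
      s (X 0 2) = X 0 2 + X 0 1 * incl Fs (entry (ρ (AlgEquiv.restrictNormalHom L s)) 1 2) +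
        incl Fs (entry (ρ (AlgEquiv.restrictNormalHom L s)) 0 2) ∧
      s (X 1 3) = X 1 3 + X 1 2 * incl Fs (entry (ρ (AlgEquiv.restrictNormalHom L s)) 2 3) +
        incl Fs (entry (ρ (AlgEquiv.restrictNormalHom L s)) 1 3) ∧
      s (X 0 3) = X 0 3 + X 0 2 * incl Fs (entry (ρ (AlgEquiv.restrictNormalHom L s)) 2 3) +
        X 0 1 * incl Fs (entry (ρ (AlgEquiv.restrictNormalHom L s)) 1 3) +
        incl Fs (entry (ρ (AlgEquiv.restrictNormalHom L s)) 0 3) := by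
    intro s
    refine ⟨?_, ?_, ?_, ?_, ?_, ?_⟩ <;>
      simp [hXs, Fin.sum_univ_four, hdiag, entry_diag, l21, l31, l32, m10, m20, m21]
    all_goals ring
  clear_value X
  -- The corrections x₀₁x₁₂ and x₀₁x₁₃ cancel, in characteristic 2, the terms in which A multiplies
  -- a matrix entry, so that ℘ of P and Y involves only elements of E.
  refine ⟨X 0 1, X 1 2, X 2 3, X 0 2 + X 0 1 * X 1 2, X 1 3, X 0 3 + X 0 1 * X 1 3,
    ⟨fun s => (expand s).1, fun s => (expand s).2.1, fun s => (expand s).2.2.1, fun s => ?_,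
      fun s => ?_, fun s => ?_⟩⟩
  all_goals
    obtain ⟨h1, h3, -, h5, h6, h7⟩ := expand s
    simp only [map_add, map_mul, h1, h3, h5, h6, h7, MonoidHom.comp_apply]
  · linear_combination
      (X 0 1 * incl Fs (entry (ρ (AlgEquiv.restrictNormalHom L s)) 1 2) : Fs) * h2
  · ring
  · linear_combination
      (X 0 1 * incl Fs (entry (ρ (AlgEquiv.restrictNormalHom L s)) 1 3) : Fs) * h2

/-- Every isomorphism of the Galois group of `L` with `U_4(𝔽₂)` gives rise to an admissible triple
that defines `L`. -/
theorem IsU4Extension.exists_isAssociated {L : IntermediateField F Fs} (hL : IsU4Extension L)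
    (ρ : Gal(L/F) ≃* unipotentGroup 4 (ZMod 2)) :
    ∃ t : Triple F Fs, t.IsAdmissible ∧ t.L = L ∧ IsAssociated L ρ t := by
  have := hL.finiteDimensional
  have := hL.isGalois
  obtain ⟨A, B, C, P, Q, Y, f⟩ := exists_isFrame ρ.toMonoidHom
  have hρ : ∀ s : Gal(Fs/F), ρ (AlgEquiv.restrictNormalHom L s) =
      (ρ.toMonoidHom.comp (AlgEquiv.restrictNormalHom L)) s := fun s => rfl
  have hr : Function.Surjective (ρ.toMonoidHom.comp (AlgEquiv.restrictNormalHom (K₁ := Fs) L)) :=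
    ρ.surjective.comp (AlgEquiv.restrictNormalHom_surjective Fs)
  have hker : ∀ s : Gal(Fs/F), (ρ.toMonoidHom.comp (AlgEquiv.restrictNormalHom L)) s = 1 ↔
      ∀ x ∈ L, s x = x := by
    intro s
    rw [← hρ, map_eq_one_iff ρ ρ.injective, ← MonoidHom.mem_ker,
      IntermediateField.restrictNormalHom_ker]
    exact ⟨fun h x hx => h ⟨x, hx⟩, fun h x => h x x.2⟩
  generalize ρ.toMonoidHom.comp (AlgEquiv.restrictNormalHom (K₁ := Fs) L) = r at f hρ hr hker
  have root : ∀ {z : Fs}, (∀ s : Gal(Fs/F), ∃ n, s z = z + incl Fs n) →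
      ∃ a : F, z ^ 2 - z = algebraMap F Fs a := by
    intro z hz
    obtain ⟨a, ha⟩ := exists_algebraMap_eq (F := F) (x := z ^ 2 - z) fun s => by
      obtain ⟨n, hn⟩ := hz s
      rw [map_sub, map_pow, hn, add_sq_sub, incl_sq_sub, add_zero]
    exact ⟨a, ha.symm⟩
  obtain ⟨a, hA⟩ := root fun s => ⟨_, f.map_A s⟩
  obtain ⟨b, hB⟩ := root fun s => ⟨_, f.map_B s⟩
  obtain ⟨c, hC⟩ := root fun s => ⟨_, f.map_C s⟩
  have h : IsRootPair (Submodule.span (ZMod 2) {cls a, cls c}) a c A C :=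
    ⟨rfl, hA, hC, fun i j => by
      obtain ⟨s, hs⟩ := hr (ofEntries i 0 j 0 0 0)
      exact ⟨s, by simp [f.map_A, hs], by simp [f.map_C, hs]⟩⟩
  have hli : LinearIndependent (ZMod 2) fun i => (cls (![a, b, c] i) : ASQuot F) := by
    refine linearIndependent_of_exists_map_eq _ ![A, B, C] (fun i => by fin_cases i <;> assumption)
      fun i => ?_
    obtain ⟨s, hs⟩ := hr (ofEntries ((Pi.single i 1 : Fin 3 → ZMod 2) 0)
      ((Pi.single i 1 : Fin 3 → ZMod 2) 1) ((Pi.single i 1 : Fin 3 → ZMod 2) 2) 0 0 0)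
    refine ⟨s, fun j => ?_⟩
    fin_cases j
    · simp [f.map_A, hs]
    · simp [f.map_B, hs]
    · simp [f.map_C, hs]
  let δ : rootField Fs (Submodule.span (ZMod 2) {cls a, cls c} : Set (ASQuot F)) :=
    ⟨Y ^ 2 - Y, f.sq_sub_mem h⟩
  have hδ : (δ : Fs) = Y ^ 2 - Y := rfl
  obtain ⟨d, d', hd, hd'⟩ := f.exists_roots h
  let t : Triple F Fs := ⟨cls b, Submodule.span (ZMod 2) {cls a, cls c}, Submodule.span _ {cls δ}⟩
  have hfix := f.map_eq_one_iff_forall (t := t) h hB hδ rfl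
  refine ⟨t, ⟨?_, ?_, f.free_span h hB hδ hd hd' hr, δ, rfl, ?_⟩, ?_,
    f.isAssociated (t := t) hker h hB hδ rfl rfl hr hρ⟩
  · have h2 := finrank_span_eq_card (hli.comp ![0, 2] (by decide))
    have : Set.range ((fun i => (cls (![a, b, c] i) : ASQuot F)) ∘ ![0, 2]) = {cls a, cls c} := by
      ext x
      simp [Fin.exists_fin_two, eq_comm]
    rw [this] at h2
    simpa using h2
  · have h3 := finrank_span_eq_card hli
    have : Submodule.span (ZMod 2) (Set.range fun i => (cls (![a, b, c] i) : ASQuot F)) =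
        t.V ⊔ Submodule.span (ZMod 2) {t.β} := by
      rw [← Submodule.span_union]
      congr 1
      ext x
      simp [Fin.exists_fin_succ, t]
      tauto
    rw [this] at h3
    simpa using h3
  · exact congrArg cls (f.trace_eq h hB hδ)
  -- Both fields are fixed by exactly the automorphisms in ker r, so they agree by the Galois
  -- correspondence.
  · apply le_antisymm
    · intro x hx
      exact mem_of_forall_fixed _ fun s hs => (hfix s).1 ((hker s).2 hs) x hx
    · intro x hx
      exact mem_of_forall_fixed _ fun s hs => (hker s).1 ((hfix s).2 hs) x hx

/-! ### From triples to extensions -/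

/-- The frame relations determine a homomorphism to `U_4(𝔽₂)`. -/
theorem exists_hom_of_relations {A B C P Q Y : Fs} {m : Gal(Fs/F) → unipotentGroup 4 (ZMod 2)}
    (hA : ∀ s, s A = A + incl Fs (entry (m s) 0 1))
    (hB : ∀ s, s B = B + incl Fs (entry (m s) 1 2))
    (hC : ∀ s, s C = C + incl Fs (entry (m s) 2 3))
    (hP : ∀ s, s P = P + incl Fs (entry (m s) 0 2) +
      incl Fs (entry (m s) 0 1) * (B + incl Fs (entry (m s) 1 2)))
    (hQ : ∀ s, s Q = Q + incl Fs (entry (m s) 2 3) * B + incl Fs (entry (m s) 1 3))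
    (hY : ∀ s, s Y = Y + incl Fs (entry (m s) 2 3) * P + incl Fs (entry (m s) 0 3) +
      incl Fs (entry (m s) 0 1) * (Q + incl Fs (entry (m s) 2 3) * B + incl Fs (entry (m s) 1 3))) :
    ∃ r : Gal(Fs/F) →* unipotentGroup 4 (ZMod 2), IsFrame r A B C P Q Y := by
  have h2 : (2 : Fs) = 0 := CharTwo.two_eq_zero
  -- Each entry of m(st) is found by expanding s(t(·)) and cancelling the common terms; the
  -- corrections in P and Y leave even multiples, which vanish.
  have e01 : ∀ s t, entry (m (s * t)) 0 1 = entry (m s) 0 1 + entry (m t) 0 1 := by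
    intro s t
    apply incl_injective (K := Fs)
    have h := hA (s * t)
    simp only [AlgEquiv.mul_apply, hA t, map_add, hA s, algEquiv_incl] at h
    rw [map_add]
    linear_combination -h
  have e12 : ∀ s t, entry (m (s * t)) 1 2 = entry (m s) 1 2 + entry (m t) 1 2 := by
    intro s t
    apply incl_injective (K := Fs)
    have h := hB (s * t)
    simp only [AlgEquiv.mul_apply, hB t, map_add, hB s, algEquiv_incl] at h
    rw [map_add]
    linear_combination -h
  have e23 : ∀ s t, entry (m (s * t)) 2 3 = entry (m s) 2 3 + entry (m t) 2 3 := by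
    intro s t
    apply incl_injective (K := Fs)
    have h := hC (s * t)
    simp only [AlgEquiv.mul_apply, hC t, map_add, hC s, algEquiv_incl] at h
    rw [map_add]
    linear_combination -h
  have e02 : ∀ s t, entry (m (s * t)) 0 2 =
      entry (m s) 0 2 + entry (m s) 0 1 * entry (m t) 1 2 + entry (m t) 0 2 := by
    intro s t
    apply incl_injective (K := Fs)
    have h := hP (s * t)
    simp only [AlgEquiv.mul_apply, hP t, map_add, map_mul, hP s, hB s, algEquiv_incl, e01, e12] at h
    simp only [map_add, map_mul]
    linear_combination -h - (incl Fs (entry (m s) 0 1) * incl Fs (entry (m t) 1 2)) * h2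
  have e13 : ∀ s t, entry (m (s * t)) 1 3 =
      entry (m s) 1 3 + entry (m s) 1 2 * entry (m t) 2 3 + entry (m t) 1 3 := by
    intro s t
    apply incl_injective (K := Fs)
    have h := hQ (s * t)
    simp only [AlgEquiv.mul_apply, hQ t, map_add, map_mul, hQ s, hB s, algEquiv_incl, e23] at h
    simp only [map_add, map_mul]
    linear_combination -h
  have e03 : ∀ s t, entry (m (s * t)) 0 3 = entry (m s) 0 3 + entry (m s) 0 2 * entry (m t) 2 3 +
      entry (m s) 0 1 * entry (m t) 1 3 + entry (m t) 0 3 := by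
    intro s t
    apply incl_injective (K := Fs)
    have h := hY (s * t)
    simp only [AlgEquiv.mul_apply, hY t, map_add, map_mul, hY s, hP s, hQ s, hB s, algEquiv_incl,
      e01, e13, e23] at h
    simp only [map_add, map_mul]
    linear_combination (exp := 1) -h - (incl Fs (entry (m s) 0 1) * incl Fs (entry (m t) 1 3)) * h2
  let r : Gal(Fs/F) →* unipotentGroup 4 (ZMod 2) := MonoidHom.mk' m fun s t => by
    apply ext_four <;> simp only [mul_entry_zero_one, mul_entry_one_two, mul_entry_two_three,
      mul_entry_zero_two, mul_entry_one_three, mul_entry_zero_three, *]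
  exact ⟨r, hA, hB, hC, hP, hQ, hY⟩

/-- Given an element `δ` of `E` with trace `b`, the roots of the Artin-Schreier polynomials of
the conjugates of `δ` form a frame. -/
theorem IsRootPair.exists_isFrame {V : Submodule (ZMod 2) (ASQuot F)} {a c : F} {A C : Fs}
    (h : IsRootPair V a c A C) (δ : rootField Fs (V : Set (ASQuot F))) {B : Fs}
    (hB : B ^ 2 - B = algebraMap F Fs (Algebra.trace F _ δ)) :
    ∃ (r : Gal(Fs/F) →* unipotentGroup 4 (ZMod 2)) (P Q Y : Fs),
      IsFrame r A B C P Q Y ∧ (δ : Fs) = Y ^ 2 - Y := by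
  have h2 : (2 : Fs) = 0 := CharTwo.two_eq_zero
  obtain ⟨γ, hγ⟩ := h.exists_lift
  obtain ⟨P, hP⟩ := exists_root F (γ (0, 1) δ - δ)
  obtain ⟨Q, hQ⟩ := exists_root F (γ (1, 0) δ - δ)
  obtain ⟨Y, hY⟩ := exists_root F (δ : Fs)
  have htr := h.algebraMap_trace hγ δ
  rw [sum_zmod_two] at htr
  -- Only i = j = 1 uses the trace: it expresses the fourth conjugate of δ through the other three
  -- and b.
  have hact : ∀ (s : Gal(Fs/F)) i j, s A = A + incl Fs i → s C = C + incl Fs j →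
      s δ = δ + incl Fs j * (P ^ 2 - P) + incl Fs i * (Q ^ 2 - Q + incl Fs j * (B ^ 2 - B)) := by
    intro s i j hi hj
    have hs : s δ = γ (i, j) δ :=
      h.eq_on_of_eq (by rw [hi, (hγ _).1]) (by rw [hj, (hγ _).2]) δ.2
    have h0 : γ (0, 0) δ = δ := h.forall_fixed (by simp [(hγ _).1]) (by simp [(hγ _).2]) δ δ.2
    rw [hs, hP, hQ, hB, htr, h0]
    rcases zmod_two_cases i with rfl | rfl <;> rcases zmod_two_cases j with rfl | rfl <;>
      simp [h0]
    linear_combination (-γ (0, 1) δ - γ (1, 0) δ) * h2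
  have hQs : ∀ (s : Gal(Fs/F)) i j, s A = A + incl Fs i → s C = C + incl Fs j →
      s (Q ^ 2 - Q) = Q ^ 2 - Q + incl Fs j * (B ^ 2 - B) := by
    intro s i j hi hj
    -- Since ℘(Q) is the difference of γ(1,0)δ and δ, applying `hact` to both s·γ(1,0) and s gives
    -- its image; ℘(P) is handled in the same way.
    have h1 := hact (s * γ (1, 0)) (1 + i) j
      (by rw [AlgEquiv.mul_apply, (hγ _).1, map_add, algEquiv_incl, hi, map_add]; ring)
      (by rw [AlgEquiv.mul_apply, (hγ _).2, map_add, algEquiv_incl, hj]; simp)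
    rw [AlgEquiv.mul_apply] at h1
    rw [hQ, map_sub, h1, hact s i j hi hj, ← hQ, map_add, map_one]
    ring
  have hPs : ∀ (s : Gal(Fs/F)) i j, s A = A + incl Fs i → s C = C + incl Fs j →
      s (P ^ 2 - P) = P ^ 2 - P + incl Fs i * (B ^ 2 - B) := by
    intro s i j hi hj
    have h1 := hact (s * γ (0, 1)) i (1 + j)
      (by rw [AlgEquiv.mul_apply, (hγ _).1, map_add, algEquiv_incl, hi]; simp)
      (by rw [AlgEquiv.mul_apply, (hγ _).2, map_add, algEquiv_incl, hj, map_add]; ring)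
    rw [AlgEquiv.mul_apply] at h1
    rw [hP, map_sub, h1, hact s i j hi hj, ← hP, map_add, map_one]
    ring
  have hm : ∀ s : Gal(Fs/F), ∃ m : unipotentGroup 4 (ZMod 2),
      s A = A + incl Fs (entry m 0 1) ∧ s B = B + incl Fs (entry m 1 2) ∧
      s C = C + incl Fs (entry m 2 3) ∧
      s P = P + incl Fs (entry m 0 2) + incl Fs (entry m 0 1) * (B + incl Fs (entry m 1 2)) ∧
      s Q = Q + incl Fs (entry m 2 3) * B + incl Fs (entry m 1 3) ∧
      s Y = Y + incl Fs (entry m 2 3) * P + incl Fs (entry m 0 3) +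
        incl Fs (entry m 0 1) * (Q + incl Fs (entry m 2 3) * B + incl Fs (entry m 1 3)) := by
    intro s
    -- The entries of m are the discrepancies left when each image is compared with a known element
    -- having the same value of ℘.
    obtain ⟨i, j, hi, hj⟩ := h.map_eq_add s
    obtain ⟨n, hn⟩ := exists_map_eq_add hB s
    obtain ⟨k, hk⟩ := exists_eq_add_incl (x := s P) (y := P + incl Fs i * (B + incl Fs n)) (by
      rw [← map_pow, ← map_sub, hPs s i j hi hj]
      simp only [add_sq_sub, incl_mul_sq_sub, incl_sq_sub, add_zero])
    obtain ⟨l, hl⟩ := exists_eq_add_incl (x := s Q) (y := Q + incl Fs j * B) (by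
      rw [← map_pow, ← map_sub, hQs s i j hi hj, add_sq_sub, incl_mul_sq_sub])
    obtain ⟨q, hq⟩ := exists_eq_add_incl (x := s Y)
      (y := Y + incl Fs j * P + incl Fs i * (Q + incl Fs j * B + incl Fs l)) (by
      rw [← map_pow, ← map_sub, hY, hact s i j hi hj]
      simp only [add_sq_sub, incl_mul_sq_sub, incl_sq_sub, add_zero, hY])
    refine ⟨ofEntries i n j k l q, hi, hn, hj, ?_, ?_, ?_⟩
    · rw [hk]; simp; ring
    · rw [hl]; simp
    · rw [hq]; simp; ring
  choose m hm using hm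
  obtain ⟨r, f⟩ := exists_hom_of_relations (fun s => (hm s).1) (fun s => (hm s).2.1)
    (fun s => (hm s).2.2.1) (fun s => (hm s).2.2.2.1) (fun s => (hm s).2.2.2.2.1)
    (fun s => (hm s).2.2.2.2.2)
  exact ⟨r, P, Q, Y, f, hY.symm⟩

/-- An admissible triple defines a `U_4(𝔽₂)`-extension, and is associated with it. -/
theorem Triple.IsAdmissible.exists_isAssociated {t : Triple F Fs} (ht : t.IsAdmissible) :
    IsU4Extension t.L ∧ ∃ ρ, IsAssociated t.L ρ t := by
  obtain ⟨δ, hW, hβ⟩ := ht.exists_generator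
  have := Module.finite_of_finrank_pos (R := ZMod 2) (M := t.V) (by rw [ht.finrank_V]; simp)
  let e := Module.finBasisOfFinrankEq (ZMod 2) t.V ht.finrank_V
  obtain ⟨a, ha⟩ := cls_surjective (e 0 : ASQuot F)
  obtain ⟨c, hc⟩ := cls_surjective (e 1 : ASQuot F)
  have hV : t.V = Submodule.span (ZMod 2) {cls a, cls c} := by
    have h1 := congrArg (Submodule.map t.V.subtype) e.span_eq
    rw [Submodule.map_span, Submodule.map_subtype_top, ← Set.range_comp] at h1
    rw [← h1, ha, hc]
    congr 1
    ext x
    simp [Fin.exists_fin_two, eq_comm]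
  -- The representative of β is the trace itself, so that a root of b fits the frame built from δ.
  set b := Algebra.trace F t.E δ with hb
  have hli : LinearIndependent (ZMod 2) fun i => (cls (![a, b, c] i) : ASQuot F) := by
    rw [linearIndependent_iff_card_eq_finrank_span, Set.finrank]
    have : Submodule.span (ZMod 2) (Set.range fun i => (cls (![a, b, c] i) : ASQuot F)) =
        t.V ⊔ Submodule.span (ZMod 2) {t.β} := by
      rw [hV, ← hβ, ← Submodule.span_union]
      congr 1
      ext x
      simp [Fin.exists_fin_succ]
      tauto
    rw [this, ht.finrank_sup, Fintype.card_fin]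
  obtain ⟨A, hA⟩ := exists_root F (algebraMap F Fs a)
  obtain ⟨B, hB⟩ := exists_root F (algebraMap F Fs b)
  obtain ⟨C, hC⟩ := exists_root F (algebraMap F Fs c)
  have hχ : ∀ i n j : ZMod 2, ∃ s : Gal(Fs/F), s A = A + incl Fs i ∧ s B = B + incl Fs n ∧
      s C = C + incl Fs j := by
    intro i n j
    obtain ⟨s, hs⟩ := exists_map_eq_of_linearIndependent ![a, b, c] ![A, B, C]
      (fun i => by fin_cases i <;> assumption) hli ![i, n, j]
    exact ⟨s, hs 0, hs 1, hs 2⟩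
  have h : IsRootPair t.V a c A C :=
    ⟨hV, hA, hC, fun i j => (hχ i 0 j).imp fun s hs => ⟨hs.1, hs.2.2⟩⟩
  obtain ⟨r, P, Q, Y, f, hδ⟩ := h.exists_isFrame δ hB
  have hentry : ∀ i n j, ∃ M ∈ r.range, entry M 0 1 = i ∧ entry M 1 2 = n ∧ entry M 2 3 = j := by
    intro i n j
    obtain ⟨s, h1, h2, h3⟩ := hχ i n j
    rw [f.map_A, add_right_inj] at h1
    rw [f.map_B, add_right_inj] at h2
    rw [f.map_C, add_right_inj] at h3
    exact ⟨r s, ⟨s, rfl⟩, incl_injective h1, incl_injective h2, incl_injective h3⟩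
  have hr : Function.Surjective r := by
    rw [← MonoidHom.range_eq_top]
    exact eq_top_of_surjective _ (hentry _ _ _) (hentry _ _ _) (hentry _ _ _)
  have hL := f.map_eq_one_iff_forall h hB hδ hW
  have hgal := IsFrame.isGalois hL
  obtain ⟨ρ, hρ⟩ := IsFrame.exists_mulEquiv hL hr
  exact ⟨⟨f.finiteDimensional hL, hgal, ⟨ρ⟩⟩, ρ, f.isAssociated hL h hB hδ hW hβ.symm hr hρ⟩

end ArtinSchreier

namespace ArtinSchreier

set_option linter.unusedSectionVars false

open unipotentGroup

/-! ### Independence of the isomorphism ρ -/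

section Uniqueness

variable {F : Type*} [Field F] [CharP F 2] {Fs : Type*} [Field Fs] [Algebra F Fs]

/-- The relations hold on a subgroup of the Galois group, and it contains the preimages of the three
generators. -/
theorem IsDual.exists_forall {L : IntermediateField F Fs}
    {ρ : Gal(L/F) ≃* unipotentGroup 4 (ZMod 2)} {a b c : F}
    (h : IsDual L (ρ.symm (unipotentGroup.elem (ZMod 2) 0 1 (by decide)))
      (ρ.symm (unipotentGroup.elem (ZMod 2) 1 2 (by decide)))
      (ρ.symm (unipotentGroup.elem (ZMod 2) 2 3 (by decide))) a b c) :
    ∃ θa θb θc : L, (θa ^ 2 - θa = algebraMap F L a ∧ θb ^ 2 - θb = algebraMap F L b ∧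
      θc ^ 2 - θc = algebraMap F L c) ∧ ∀ g : Gal(L/F), g θa = θa + incl L (entry (ρ g) 0 1) ∧
      g θb = θb + incl L (entry (ρ g) 1 2) ∧ g θc = θc + incl L (entry (ρ g) 2 3) := by
  obtain ⟨θa, θb, θc, hroot, h1, h2, h3⟩ := h
  refine ⟨θa, θb, θc, hroot, ?_⟩
  let H : Subgroup Gal(L/F) :=
    { carrier := {g | g θa = θa + incl L (entry (ρ g) 0 1) ∧
        g θb = θb + incl L (entry (ρ g) 1 2) ∧ g θc = θc + incl L (entry (ρ g) 2 3)}
      one_mem' := by simp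
      mul_mem' := by
        rintro g g' ⟨e1, e2, e3⟩ ⟨e1', e2', e3'⟩
        refine ⟨?_, ?_, ?_⟩ <;>
          simp only [AlgEquiv.mul_apply, e1, e2, e3, e1', e2', e3', map_add, map_mul, algEquiv_incl,
            mul_entry_zero_one, mul_entry_one_two, mul_entry_two_three, add_assoc]
      inv_mem' := by
        rintro g ⟨e1, e2, e3⟩
        refine ⟨?_, ?_, ?_⟩ <;> apply g.injective <;>
          simp only [← AlgEquiv.mul_apply, mul_inv_cancel, AlgEquiv.one_apply, map_add, map_inv,
            e1, e2, e3, algEquiv_incl, entry_inv_zero_one, entry_inv_one_two, entry_inv_two_three,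
            map_neg, add_neg_cancel_right] }
  have hH : H.map ρ.toMonoidHom = ⊤ := by
    have mem_map : ∀ M, ρ.symm M ∈ H → M ∈ H.map ρ.toMonoidHom := fun M hM =>
      ⟨_, hM, ρ.apply_symm_apply M⟩
    rw [elem_zero_one] at h1
    rw [elem_one_two] at h2
    rw [elem_two_three] at h3
    exact eq_top_of_surjective _ ⟨_, mem_map (ofEntries 1 0 0 0 0 0) (by simp [H, h1]), by simp⟩
      ⟨_, mem_map (ofEntries 0 1 0 0 0 0) (by simp [H, h2]), by simp⟩
      ⟨_, mem_map (ofEntries 0 0 1 0 0 0) (by simp [H, h3]), by simp⟩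
  intro g
  have hg : ρ g ∈ H.map ρ.toMonoidHom := hH ▸ Subgroup.mem_top _
  obtain ⟨g', hg', he⟩ := hg
  obtain rfl : g' = g := ρ.injective he
  exact hg'

/-- The difference θ - η is Galois invariant, hence lies in F, and a - b is its image under ℘. -/
theorem cls_eq_of_forall {L : IntermediateField F Fs} [IsGalois F L] {a b : F} {θ η : L}
    (hθ : θ ^ 2 - θ = algebraMap F L a) (hη : η ^ 2 - η = algebraMap F L b)
    (h : ∀ g : Gal(L/F), g θ - θ = g η - η) : cls a = cls b := by
  obtain ⟨z, hz⟩ := (InfiniteGalois.mem_range_algebraMap_iff_fixed (k := F) (θ - η)).2 fun g => by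
    rw [map_sub]
    linear_combination h g
  refine (cls_eq_cls_iff _ _).2 ⟨z, (algebraMap F L).injective ?_⟩
  rw [map_add, map_sub, map_pow, hz, ← hθ, ← hη, ← add_sq_sub, add_sub_cancel]

/-- The characters of a' and c', transported by ρ' ∘ ρ⁻¹, are combinations of those of a and c by
`exists_character_map_eq`. -/
theorem span_le_span_of_isDual {L : IntermediateField F Fs} [IsGalois F L]
    {ρ ρ' : Gal(L/F) ≃* unipotentGroup 4 (ZMod 2)} {a c a' c' : F} {θa θc θa' θc' : L}
    (ha : θa ^ 2 - θa = algebraMap F L a) (hc : θc ^ 2 - θc = algebraMap F L c)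
    (ha' : θa' ^ 2 - θa' = algebraMap F L a') (hc' : θc' ^ 2 - θc' = algebraMap F L c')
    (h : ∀ g : Gal(L/F), g θa = θa + incl L (entry (ρ g) 0 1) ∧
      g θc = θc + incl L (entry (ρ g) 2 3))
    (h' : ∀ g : Gal(L/F), g θa' = θa' + incl L (entry (ρ' g) 0 1) ∧
      g θc' = θc' + incl L (entry (ρ' g) 2 3)) :
    Submodule.span (ZMod 2) {cls a', cls c'} ≤ Submodule.span (ZMod 2) {cls a, cls c} := by
  have key : ∀ (φ : unipotentGroup 4 (ZMod 2) → ZMod 2) (u : F) (η : L),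
      (∀ M N, φ (M * N) = φ M + φ N) → (∀ M, entry M 0 1 = 0 → entry M 2 3 = 0 → φ M = 0) →
      η ^ 2 - η = algebraMap F L u → (∀ g : Gal(L/F), g η = η + incl L (φ (ρ' g))) →
      cls u ∈ Submodule.span (ZMod 2) {cls a, cls c} := by
    intro φ u η hφ h0 hu hη
    obtain ⟨x, z, hxz⟩ := exists_character_map_eq (ρ.symm.trans ρ') hφ h0
    rw [Submodule.mem_span_pair]
    refine ⟨x, z, ?_⟩
    rw [smul_cls, smul_cls, ← map_add]
    refine cls_eq_of_forall (θ := incl L x * θa + incl L z * θc) (η := η) ?_ hu fun g => ?_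
    · rw [add_sq_sub, incl_mul_sq_sub, incl_mul_sq_sub, ha, hc]
      simp [map_incl]
    · have := hxz (ρ g)
      rw [MulEquiv.trans_apply, MulEquiv.symm_apply_apply] at this
      simp only [map_add, map_mul, algEquiv_incl, (h g).1, (h g).2, hη, this]
      ring
  rw [Submodule.span_le]
  rintro _ (rfl | rfl)
  · exact key (entry · 0 1) a' θa' (fun _ _ => by simp) (fun _ h _ => h) ha' fun g => (h' g).1
  · exact key (entry · 2 3) c' θc' (fun _ _ => by simp) (fun _ _ h => h) hc' fun g => (h' g).2

/-- The triple associated with a Galois extension does not depend on any choice. -/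
theorem IsAssociated.unique {L : IntermediateField F Fs} [IsGalois F L]
    {ρ ρ' : Gal(L/F) ≃* unipotentGroup 4 (ZMod 2)} {t t' : Triple F Fs}
    (h : IsAssociated L ρ t) (h' : IsAssociated L ρ' t') : t = t' := by
  obtain ⟨a, b, c, hd, hβ, hV, hW⟩ := h
  obtain ⟨a', b', c', hd', hβ', hV', hW'⟩ := h'
  obtain ⟨θa, θb, θc, ⟨ha, hb, hc⟩, hg⟩ := hd.exists_forall
  obtain ⟨θa', θb', θc', ⟨ha', hb', hc'⟩, hg'⟩ := hd'.exists_forall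
  have e1 : t.β = t'.β := by
    rw [hβ, hβ']
    refine cls_eq_of_forall hb hb' fun g => ?_
    have := entry_one_two_map (ρ.symm.trans ρ') (ρ g)
    rw [MulEquiv.trans_apply, MulEquiv.symm_apply_apply] at this
    rw [(hg g).2.1, (hg' g).2.1, this]
    ring
  have e2 : t.V = t'.V := by
    rw [hV, hV']
    apply le_antisymm
    · exact span_le_span_of_isDual ha' hc' ha hc (fun g => ⟨(hg' g).1, (hg' g).2.2⟩)
        fun g => ⟨(hg g).1, (hg g).2.2⟩
    · exact span_le_span_of_isDual ha hc ha' hc' (fun g => ⟨(hg g).1, (hg g).2.2⟩)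
        fun g => ⟨(hg' g).1, (hg' g).2.2⟩
  clear hβ hV hβ' hV'
  obtain ⟨β, V, W⟩ := t
  obtain ⟨β', V', W'⟩ := t'
  simp only at e1 e2
  subst e1 e2
  congr 1
  ext x
  obtain ⟨e, rfl⟩ := cls_surjective x
  exact (hW e).trans (hW' e).symm

end Uniqueness

end ArtinSchreier
end

/-! ### The bijection and its inverse -/

theorem mainTheorem2 (F : Type*) [Field F] [CharP F 2]
    (Fs : Type*) [Field Fs] [Algebra F Fs] [IsSepClosure F Fs] :
    ∃ Φ : {t : ArtinSchreier.Triple F Fs // t.IsAdmissible} ≃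
        {L : IntermediateField F Fs // ArtinSchreier.IsU4Extension L},
      (∀ t, (Φ t : IntermediateField F Fs) = t.1.L) ∧
      ∀ (L : {L : IntermediateField F Fs // ArtinSchreier.IsU4Extension L})
        (ρ : Gal(L.1/F) ≃* unipotentGroup 4 (ZMod 2)) (t : ArtinSchreier.Triple F Fs),
        ArtinSchreier.IsAssociated L.1 ρ t ↔ t = (Φ.symm L).1 := by
  have : CharP Fs 2 := charP_of_injective_algebraMap (algebraMap F Fs).injective 2
  have hA := fun (t : ArtinSchreier.Triple F Fs) (ht : t.IsAdmissible) => ht.exists_isAssociated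
  let φ : {t : ArtinSchreier.Triple F Fs // t.IsAdmissible} →
      {L : IntermediateField F Fs // ArtinSchreier.IsU4Extension L} :=
    fun t => ⟨t.1.L, (hA t.1 t.2).1⟩
  have hinj : Function.Injective φ := by
    rintro ⟨t, ht⟩ ⟨t', ht'⟩ h
    have hL : t.L = t'.L := congrArg Subtype.val h
    obtain ⟨hU, ρ, hρ⟩ := hA t ht
    -- Both triples are associated with the same field, each through its own isomorphism, and
    -- uniqueness applies across different ρ.
    obtain ⟨ρ', hρ'⟩ : ∃ ρ', ArtinSchreier.IsAssociated t.L ρ' t' := hL ▸ (hA t' ht').2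
    have := hU.isGalois
    exact Subtype.ext (hρ.unique hρ')
  have hsurj : Function.Surjective φ := by
    rintro ⟨L, hL⟩
    obtain ⟨ρ⟩ := hL.nonempty_mulEquiv
    obtain ⟨t, ht, htL, -⟩ := hL.exists_isAssociated ρ
    exact ⟨⟨t, ht⟩, Subtype.ext htL⟩
  let Φ := Equiv.ofBijective φ ⟨hinj, hsurj⟩
  refine ⟨Φ, fun t => rfl, fun L ρ t => ?_⟩
  have := L.2.isGalois
  obtain ⟨t₀, ht₀, htL, hass⟩ := L.2.exists_isAssociated ρ
  have h₀ : (Φ.symm L).1 = t₀ := by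
    have : Φ ⟨t₀, ht₀⟩ = L := Subtype.ext htL
    rw [← this, Equiv.symm_apply_apply]
  rw [h₀]
  constructor
  · intro h
    exact h.unique hass
  · rintro rfl
    exact hass
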